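/- Let $p$ be an odd prime, $V$ an $n$-dimensional vector space over $\mathbb F_p$ with a non-degenerate symmetric bilinear form $\langle\cdot,\cdot\rangle$, and $\xi=e^{2\pi\sqrt{-1}/p}$. For $f:V\to\mathbb F_p$ put $\widehat{\chi_f}(\alpha)=\sum_{x\in V}\xi^{f(x)-\langle\alpha,x\rangle}$. Let $0\le s\le n$; $f$ is $s$-plateaued if $|\widehat{\chi_f}(\alpha)|\in\{0,p^{(n+s)/2}\}$ for all $\alpha\in V$, and then $S=\{\alpha: |\widehat{\chi_f}(\alpha)|=p^{(n+s)/2}\}$. Let $\mu=1$ if $p^{n+s}\equiv1\pmod 4$ and $\mu=\sqrt{-1}$ otherwise. For $\alpha\in S$ one has $\widehat{\chi_f}(\alpha)=\epsilon_\alpha\,\mu\, p^{(n+s)/2}\xi^{f^*(\alpha)}$ with a unique sign $\epsilon_\alpha=\pm1$ and a unique $f^*(\alpha)\in\mathbb F_p$; the function $f^*:S\to\mathbb F_p$ is the dual of $f$. Put $\widehat{\chi_{f^*}}(\alpha)=\sum_{x\in S}\xi^{f^*(x)-\langle\alpha,x\rangle}$ and $B_\pm(f^*)=\{\alpha\in V:\widehat{\chi_{f^*}}(\alpha)=\pm\mu\,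 p^{(n-s)/2}\xi^{f(-\alpha)}\}$. Let $\mathscr F$ be the class of $s$-plateaued $f$ such that (1) $f(0)=0$; (2) $|\widehat{\chi_{f^*}}(\alpha)|=(\#S)^{1/2}$ for all $\alpha\in V$; (3) each of $B_+(f^*)$ and $B_-(f^*)$ is closed under multiplication by elements of $\mathbb F_p^*$; (4) there are integers $t,t'$ with $2\le t,t'\le p-1$ and $\gcd(t-1,p-1)=\gcd(t'-1,p-1)=1$ such that, for all $a\in\mathbb F_p^*$, $f(ax)=a^tf(x)$ for $x\in B_+(f^*)$ and $f(ax)=a^{t'}f(x)$ for $x\in B_-(f^*)$. **Theorem 10.** Let $f\in\mathscr F$ be $s$-plateaued, and let $$\widetilde{\mathcal C}_f=\{(af(x)+\langle b,x\rangle)_{x\in V,\,f(x)\ne0}: a\in\mathbb F_p,\ b\in V\}.$$ Suppose that either (i) $n+s$ is even, $0\le s\le n-2$, $n+s\ge 6$ if $p=3$ and $n+s\ge4$ if $p\neq3$; put $N=(p-1)\bigl(p^{n-1}-\epsilon_0p^{\frac{n+s}2-1}\bigr)$, where $\epsilon_0=\pm1$ is the sign $\epsilon_\alpha$ at $\alpha=0$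 (which lies in $S$); or (ii) $n+s$ is odd, $0\le s\le n-1$, $n+s\ge5$ if $p=3$ and $n+s\ge3$ if $p\ne3$; put $N=(p-1)p^{n-1}$. Then for every generator matrix $G$ of $\widetilde{\mathcal C}_f$ with $n+1$ rows (rows forming a basis of the code), the code $\mathcal C$ generated by $[I_{n+1},G]$ is an LCD code (that is, $\mathcal C\cap\mathcal C^\perp=\{0\}$) over $\mathbb F_p$ of length $N+n+1$ and dimension $n+1$, and its dual $\mathcal C^\perp$ is an LCD code of length $N+n+1$ and dimension $N$. Moreover, for every basis $\alpha_1,\dots,\alpha_n$ of $V$, the matrix $G$ with rows $(f(x))_x,(\langle\alpha_1,x\rangle)_x,\dots,(\langle\alpha_n,x\rangle)_x$ (where $x$ runs through the points of $V$ with $f(x)\ne0$) is a generator matrix of $\widetilde{\mathcal C}_f$, and for this $G$ the minimum distance of $\mathcal C^\perp$ is $3$. -/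

import Mathlib

noncomputable section

namespace PlateauedLCD

section Plateaued

open Classical

variable {p : ℕ} [Fact p.Prime] {V : Type*} [AddCommGroup V] [Module (ZMod p) V] [Fintype V]

/-- The exponential sum `∑ x ∈ S, ξ ^ (g x - ⟨α, x⟩)` with `ξ = exp (2 π i / p)`, where the
inner product of `V` is the bilinear form `B`. -/
def walshOn (B : LinearMap.BilinForm (ZMod p) V) (S : Finset V) (g : V → ZMod p) (α : V) : ℂ :=
  ∑ x ∈ S, ZMod.stdAddChar (g x - B α x)

/-- The Walsh transform of `f : V → 𝔽_p`. -/
def walsh (B : LinearMap.BilinForm (ZMod p) V) (f : V → ZMod p) (α : V) : ℂ :=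
  walshOn B Finset.univ f α

variable (p) in
/-- The real number `p ^ (m / 2)`. -/
def halfPow (m : ℕ) : ℝ := Real.sqrt p ^ m

variable (p V) in
/-- The dimension of `V` over `𝔽_p`. -/
def dim : ℕ := Module.finrank (ZMod p) V

/-- `f` is `s`-plateaued: `0 ≤ s ≤ n` and the modulus of every Walsh coefficient is `0` or
`p ^ ((n + s) / 2)`. -/
def IsPlateaued (B : LinearMap.BilinForm (ZMod p) V) (s : ℕ) (f : V → ZMod p) : Prop :=
  s ≤ dim p V ∧ ∀ α : V, ‖walsh B f α‖ = 0 ∨ ‖walsh B f α‖ = halfPow p (dim p V + s)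

/-- The Walsh support of an `s`-plateaued function. -/
def walshSupport (B : LinearMap.BilinForm (ZMod p) V) (s : ℕ) (f : V → ZMod p) : Finset V :=
  Finset.univ.filter fun α => ‖walsh B f α‖ = halfPow p (dim p V + s)

variable (p V) in
/-- `μ = 1` if `p ^ (n + s) ≡ 1 (mod 4)`, and `μ = √-1` if `p ^ (n + s) ≡ 3 (mod 4)`
(the only two cases, since `p` is odd). -/
def mu (s : ℕ) : ℂ := if p ^ (dim p V + s) % 4 = 1 then 1 else Complex.I

/-- The dual `f*` of an `s`-plateaued function `f`: at `α` in the Walsh support, `f*(α)` is the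
`j ∈ 𝔽_p` such that the Walsh coefficient at `α` equals `± μ p ^ ((n + s) / 2) ξ ^ j`.
(The function is only ever used on the Walsh support; its value elsewhere is irrelevant.) -/
def dual (B : LinearMap.BilinForm (ZMod p) V) (s : ℕ) (f : V → ZMod p) (α : V) : ZMod p :=
  if h : ∃ j : ZMod p,
      walsh B f α = mu p V s * halfPow p (dim p V + s) * ZMod.stdAddChar j ∨
      walsh B f α = -(mu p V s * halfPow p (dim p V + s) * ZMod.stdAddChar j)
  then h.choose else 0

/-- `B_+(f)`. -/
def BPlus (B : LinearMap.BilinForm (ZMod p) V) (s : ℕ) (f : V → ZMod p) : Set V :=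
  {α | α ∈ walshSupport B s f ∧
    walsh B f α = mu p V s * halfPow p (dim p V + s) * ZMod.stdAddChar (dual B s f α)}

/-- `B_-(f)`. -/
def BMinus (B : LinearMap.BilinForm (ZMod p) V) (s : ℕ) (f : V → ZMod p) : Set V :=
  {α | α ∈ walshSupport B s f ∧
    walsh B f α = -(mu p V s * halfPow p (dim p V + s) * ZMod.stdAddChar (dual B s f α))}

/-- The sign `ε_α`, for `α` in the Walsh support: `1` on `B_+(f)` and `-1` on `B_-(f)`
(and `0` off the Walsh support). -/
def eps (B : LinearMap.BilinForm (ZMod p) V) (s : ℕ) (f : V → ZMod p) (α : V) : ℤ :=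
  if α ∈ BPlus B s f then 1 else if α ∈ BMinus B s f then -1 else 0

/-- `g` is bent relative to `S`: `|∑ x ∈ S, ξ ^ (g x - ⟨α, x⟩)| = (#S) ^ (1 / 2)` for all `α`. -/
def IsBentRelative (B : LinearMap.BilinForm (ZMod p) V) (S : Finset V) (g : V → ZMod p) : Prop :=
  ∀ α : V, ‖walshOn B S g α‖ = Real.sqrt S.card

/-- `B_+(f*)`. -/
def dualBPlus (B : LinearMap.BilinForm (ZMod p) V) (s : ℕ) (f : V → ZMod p) : Set V :=
  {α | walshOn B (walshSupport B s f) (dual B s f) α =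
    mu p V s * halfPow p (dim p V - s) * ZMod.stdAddChar (f (-α))}

/-- `B_-(f*)`. -/
def dualBMinus (B : LinearMap.BilinForm (ZMod p) V) (s : ℕ) (f : V → ZMod p) : Set V :=
  {α | walshOn B (walshSupport B s f) (dual B s f) α =
    -(mu p V s * halfPow p (dim p V - s) * ZMod.stdAddChar (f (-α)))}

/-- There is an integer `t` with `2 ≤ t ≤ p - 1`, `gcd (t - 1, p - 1) = 1` and
`f (a x) = a ^ t f x` for all `a ∈ 𝔽_p^*` and `x ∈ S`. -/
def IsFormOn (f : V → ZMod p) (S : Set V) : Prop :=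
  ∃ t : ℕ, 2 ≤ t ∧ t ≤ p - 1 ∧ Nat.gcd (t - 1) (p - 1) = 1 ∧
    ∀ a : ZMod p, a ≠ 0 → ∀ x ∈ S, f (a • x) = a ^ t * f x

/-- The `s`-plateaued functions that belong to the class `𝓕`. -/
structure MemF (B : LinearMap.BilinForm (ZMod p) V) (s : ℕ) (f : V → ZMod p) : Prop where
  plateaued : IsPlateaued B s f
  map_zero : f 0 = 0
  dual_bent : IsBentRelative B (walshSupport B s f) (dual B s f)
  smul_mem_plus : ∀ a : ZMod p, a ≠ 0 → ∀ x ∈ dualBPlus B s f, a • x ∈ dualBPlus B s f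
  smul_mem_minus : ∀ a : ZMod p, a ≠ 0 → ∀ x ∈ dualBMinus B s f, a • x ∈ dualBMinus B s f
  form_plus : IsFormOn f (dualBPlus B s f)
  form_minus : IsFormOn f (dualBMinus B s f)

end Plateaued

section Codes

variable {p : ℕ} {ι : Type*} [Fintype ι]

/-- `C` is a `p`-ary linear code of length `N` and dimension `K`, with coordinates indexed
by `ι`. -/
def HasParams (C : Submodule (ZMod p) (ι → ZMod p)) (N K : ℤ) : Prop :=
  (Fintype.card ι : ℤ) = N ∧ (Module.finrank (ZMod p) C : ℤ) = K

/-- The minimum Hamming distance of `C` is `d`. -/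
def HasMinDist (C : Submodule (ZMod p) (ι → ZMod p)) (d : ℕ) : Prop :=
  IsLeast {w : ℕ | ∃ c ∈ C, ∃ c' ∈ C, c ≠ c' ∧ hammingDist c c' = w} d

/-- The (Euclidean) dual code. -/
def dualCode (C : Submodule (ZMod p) (ι → ZMod p)) : Submodule (ZMod p) (ι → ZMod p) where
  carrier := {x | ∀ y ∈ C, x ⬝ᵥ y = 0}
  add_mem' := by
    intro a b ha hb y hy
    rw [add_dotProduct, ha y hy, hb y hy, add_zero]
  zero_mem' := by
    intro y _
    exact zero_dotProduct y
  smul_mem' := by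
    intro c x hx y hy
    rw [smul_dotProduct, hx y hy, smul_zero]

/-- `C` is a linear complementary dual code. -/
def IsLCD (C : Submodule (ZMod p) (ι → ZMod p)) : Prop := C ⊓ dualCode C = ⊥

/-- The code generated by a matrix: the span of its rows. -/
def rowSpan {k : Type*} (G : Matrix k ι (ZMod p)) : Submodule (ZMod p) (ι → ZMod p) :=
  Submodule.span (ZMod p) (Set.range G.row)

/-- `G` is a generator matrix of `C`: its rows form a basis of `C`. -/
def IsGeneratorMatrix {k : Type*} (G : Matrix k ι (ZMod p))
    (C : Submodule (ZMod p) (ι → ZMod p)) : Prop :=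
  LinearIndependent (ZMod p) G.row ∧ rowSpan G = C

end Codes

section PlateauedCodes

variable {p : ℕ} {V : Type*} [AddCommGroup V] [Module (ZMod p) V]

/-- The code of all words `(a f(x) + ⟨b, x⟩)`, `a ∈ 𝔽_p`, `b ∈ V`, where `x` runs through the
points of `V` with `f x ≠ 0`. -/
def codeF (B : LinearMap.BilinForm (ZMod p) V) (f : V → ZMod p) :
    Submodule (ZMod p) ({x : V // f x ≠ 0} → ZMod p) where
  carrier := {c | ∃ (a : ZMod p) (b : V), ∀ x : {x : V // f x ≠ 0}, c x = a * f x + B b x}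
  add_mem' := by
    rintro c c' ⟨a, b, h⟩ ⟨a', b', h'⟩
    refine ⟨a + a', b + b', fun x => ?_⟩
    rw [Pi.add_apply, h x, h' x, map_add, LinearMap.add_apply]
    ring
  zero_mem' := ⟨0, 0, fun x => by simp⟩
  smul_mem' := by
    rintro r c ⟨a, b, h⟩
    refine ⟨r * a, r • b, fun x => ?_⟩
    rw [Pi.smul_apply, h x, map_smul, LinearMap.smul_apply, smul_eq_mul, smul_eq_mul]
    ring

/-- The matrix with rows `(f(x))`, `(⟨α_1, x⟩)`, …, `(⟨α_n, x⟩)`, where `x` runs through the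
points of `V` with `f x ≠ 0`. -/
def stdMatrix {n : ℕ} (B : LinearMap.BilinForm (ZMod p) V) (f : V → ZMod p) (α : Fin n → V) :
    Matrix (Fin (n + 1)) {x : V // f x ≠ 0} (ZMod p) :=
  Matrix.of (Fin.cons (fun x => f x) fun i x => B (α i) x)

/-- The code generated by the matrix `[I, G]`. -/
def augCode {k ι : Type*} [DecidableEq k] (G : Matrix k ι (ZMod p)) :
    Submodule (ZMod p) (k ⊕ ι → ZMod p) :=
  rowSpan (Matrix.fromCols (1 : Matrix k k (ZMod p)) G)

end PlateauedCodes

end PlateauedLCD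

end

set_option linter.unusedSectionVars false

/-! The engine is self-orthogonality. If any two words of the code of `f` have dot product zero,
then for `[I, G]` the words `(u, uG)` and `(v, vG)` have dot product `u ⬝ᵥ v`, so the hull is
trivial (`isLCD_augCode`), and the dual code inherits the property.

Self-orthogonality (`codeF_dotProduct`) needs three sums over the support of `f` to vanish mod `p`.
The sum of `f²` vanishes because all fibres of `f` have size divisible by `p`. The mixed sum of `f`
times a linear form vanishes because `f` is even. The sum of a squared linear form is multiplied by
4 under `x ↦ 2x`, hence vanishes if `p ≠ 3`; for `p = 3` the joint fibres of `f` and the form have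
size divisible by `p`.

Evenness and homogeneity of `f` rest on every vector lying in `B_+(f*)` or `B_-(f*)`
(`mem_dualBPlus_or_mem_dualBMinus`). All Walsh values are read in `ℤ[ζ]`. Those of modulus `p ^ (m /
2)` are `± g ^ m ζ ^ j`, with `g` the quadratic Gauss sum (`eq_mul_rootChar_of_norm`). Modulo 2 the
signs disappear and `g ≡ 1`, while distinct powers of `ζ` stay distinct, so the exponent `j` is
visible mod 2. The transform of `f*` is congruent mod 2 to its version weighted by the signs `ε_α`,
which Fourier inversion computes.

The length comes from counting zeros of `f` by the Galois conjugates of the Walsh value at 0. The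
dual distance is 3 because `f (a x) = a f x ≠ 0` with `a ≠ 0` forces `a = 1`: no two columns of `[I,
G]` are proportional, while the columns at `2d` and `d` combine to a multiple of the first unit
vector. -/

noncomputable section

namespace PlateauedLCD

/-! ### Arithmetic of the ring of integers of the `p`-th cyclotomic field. -/

section Cyclotomic

open NumberField IsCyclotomicExtension

variable (p : ℕ) [Fact p.Prime]

/-- The `p`-th cyclotomic field. -/
abbrev CycField : Type := CyclotomicField p ℚ

/-- The ring of integers of the `p`-th cyclotomic field. -/
abbrev CycInt : Type := 𝓞 (CycField p)

instance : NeZero ((p : ℕ) : ℚ) := ⟨by exact_mod_cast (Fact.out : p.Prime).ne_zero⟩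

instance : IsCyclotomicExtension {p} ℚ (CycField p) := CyclotomicField.isCyclotomicExtension p ℚ

theorem zetaSpec : IsPrimitiveRoot (zeta p ℚ (CycField p)) p := zeta_spec p ℚ _

/-- The additive character of `𝔽_p` with values in the cyclotomic integers. -/
def rootChar : AddChar (ZMod p) (CycInt p) :=
  AddChar.zmodChar p (ζ := (zetaSpec p).toInteger) (zetaSpec p).toInteger_isPrimitiveRoot.pow_eq_one

theorem rootChar_primitive : (rootChar p).IsPrimitive :=
  AddChar.zmodChar_primitive_of_primitive_root p (zetaSpec p).toInteger_isPrimitiveRoot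

theorem rootChar_natCast (a : ℕ) : rootChar p (a : ZMod p) = (zetaSpec p).toInteger ^ a :=
  AddChar.zmodChar_apply' _ a

theorem rootChar_one : rootChar p 1 = (zetaSpec p).toInteger := by
  have := rootChar_natCast p 1
  simpa using this

theorem stdAddChar_one_primitive : IsPrimitiveRoot (ZMod.stdAddChar (1 : ZMod p)) p := by
  have : ZMod.stdAddChar (1 : ZMod p) = Complex.exp (2 * Real.pi * Complex.I / p) := by
    have := ZMod.stdAddChar_coe (N := p) 1
    simpa using this
  rw [this]
  exact Complex.isPrimitiveRoot_exp p (NeZero.ne p)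

/-- The embedding of the cyclotomic field into `ℂ` with `ζ ↦ exp (2 π i / p)`. -/
def fieldEmb : CycField p →ₐ[ℚ] ℂ :=
  ((zetaSpec p).embeddingsEquivPrimitiveRoots ℂ
    (Polynomial.cyclotomic.irreducible_rat (NeZero.pos p))).symm
    ⟨ZMod.stdAddChar (1 : ZMod p), (mem_primitiveRoots (NeZero.pos p)).2 (stdAddChar_one_primitive p)⟩

theorem fieldEmb_zeta : fieldEmb p (zeta p ℚ (CycField p)) = ZMod.stdAddChar (1 : ZMod p) := by
  have := (zetaSpec p).embeddingsEquivPrimitiveRoots_apply_coe ℂ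
    (Polynomial.cyclotomic.irreducible_rat (NeZero.pos p)) (fieldEmb p)
  rw [← this, fieldEmb, Equiv.apply_symm_apply]

/-- The embedding of the cyclotomic integers into `ℂ`. -/
def intEmb : CycInt p →+* ℂ := (fieldEmb p : CycField p →+* ℂ).comp (algebraMap (CycInt p) (CycField p))

theorem intEmb_injective : Function.Injective (intEmb p) :=
  (fieldEmb p : CycField p →+* ℂ).injective.comp RingOfIntegers.coe_injective

theorem intEmb_rootChar (j : ZMod p) : intEmb p (rootChar p j) = ZMod.stdAddChar j := by
  obtain ⟨a, rfl⟩ := ZMod.natCast_zmod_surjective j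
  rw [rootChar_natCast, map_pow]
  have h : intEmb p (zetaSpec p).toInteger = ZMod.stdAddChar (1 : ZMod p) := fieldEmb_zeta p
  rw [h, ← AddChar.map_nsmul_eq_pow, nsmul_one]

theorem norm_stdAddChar (j : ZMod p) : ‖ZMod.stdAddChar j‖ = 1 := by
  rw [ZMod.stdAddChar_apply, Circle.norm_coe]

theorem conj_stdAddChar (j : ZMod p) : (starRingEnd ℂ) (ZMod.stdAddChar j) = ZMod.stdAddChar (-j) := by
  rw [AddChar.map_neg_eq_inv, Complex.inv_def, Complex.normSq_eq_norm_sq, norm_stdAddChar]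
  simp

/-- The quotient is rational and integral over `ℤ`, hence an integer. This brings divisibilities in
the cyclotomic ring back to `ℤ`. -/
theorem intCast_dvd_intCast {a b : ℤ} (h : (a : CycInt p) ∣ (b : CycInt p)) : a ∣ b := by
  obtain ⟨c, hc⟩ := h
  rcases eq_or_ne a 0 with rfl | ha
  · simp only [Int.cast_zero, zero_mul, Int.cast_eq_zero] at hc
    simp [hc]
  have h1 : IsIntegral ℤ ((b / a : ℚ) : CycField p) := by
    have : ((b / a : ℚ) : CycField p) = (c : CycField p) := by
      have h2 := congrArg (algebraMap (CycInt p) (CycField p)) hc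
      simp only [map_mul, map_intCast] at h2
      have ha' : (a : CycField p) ≠ 0 := by exact_mod_cast ha
      push_cast
      rw [div_eq_iff ha', h2, mul_comm]
    rw [this]
    exact RingOfIntegers.isIntegral_coe c
  have h2 : IsIntegral ℤ (b / a : ℚ) := by
    rwa [← isIntegral_algebraMap_iff (A := ℚ) (B := CycField p) (algebraMap ℚ (CycField p)).injective]
  obtain ⟨k, hk⟩ := IsIntegrallyClosed.isIntegral_iff.1 h2
  refine ⟨k, ?_⟩
  have ha' : (a : ℚ) ≠ 0 := by exact_mod_cast ha
  rw [eq_div_iff ha'] at hk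
  simp only [eq_intCast] at hk
  rw [mul_comm]
  exact_mod_cast hk.symm

/-- The automorphism `ζ ↦ ζ ^ a` of the cyclotomic integers. -/
def galAut (a : (ZMod p)ˣ) : CycInt p →+* CycInt p :=
  MulSemiringAction.toRingHom Gal(CycField p/ℚ) (CycInt p)
    ((IsCyclotomicExtension.Rat.galEquivZMod p (CycField p)).symm a)

theorem galAut_rootChar (a : (ZMod p)ˣ) (j : ZMod p) :
    galAut p a (rootChar p j) = rootChar p (a * j) := by
  have h : (rootChar p j) ^ p = 1 := by
    rw [← AddChar.map_nsmul_eq_pow, nsmul_eq_mul, CharP.cast_eq_zero, zero_mul, AddChar.map_zero_eq_one]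
  have := IsCyclotomicExtension.Rat.galEquivZMod_smul_of_pow_eq p (CycField p)
    ((IsCyclotomicExtension.Rat.galEquivZMod p (CycField p)).symm a) h
  rw [MulEquiv.apply_symm_apply, ← AddChar.map_nsmul_eq_pow, nsmul_eq_mul, ZMod.natCast_zmod_val] at this
  exact this

variable {p}

/-- A Galois conjugate of the divisibility `ζ - 1 ∣ p`. -/
theorem one_sub_rootChar_dvd {j : ZMod p} (hj : j ≠ 0) : 1 - rootChar p j ∣ (p : CycInt p) := by
  have h1 : (1 - rootChar p 1) ∣ (p : CycInt p) := by
    rw [rootChar_one, ← neg_sub, neg_dvd]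
    exact (zetaSpec p).toInteger_sub_one_dvd_prime'
  have h2 := map_dvd (galAut p (Units.mk0 j hj)) h1
  simpa [galAut_rootChar] using h2

/-- Up to a unit, the difference of two distinct `p`-th roots of unity is some `1 - ζ ^ i`, a
divisor of the odd number `p`; so 2 cannot divide it. -/
theorem eq_of_two_dvd_rootChar_sub (hp : p ≠ 2) {j k : ZMod p}
    (h : (2 : CycInt p) ∣ rootChar p j - rootChar p k) : j = k := by
  by_contra hjk
  have h1 : (2 : CycInt p) ∣ 1 - rootChar p (k - j) := by
    have h2 := h.mul_left (rootChar p (-j))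
    rwa [mul_sub, ← AddChar.map_add_eq_mul, ← AddChar.map_add_eq_mul, neg_add_cancel,
      AddChar.map_zero_eq_one, neg_add_eq_sub] at h2
  have h3 := h1.trans (one_sub_rootChar_dvd (sub_ne_zero.2 (Ne.symm hjk)))
  have h4 : (2 : ℤ) ∣ p := intCast_dvd_intCast p (by exact_mod_cast h3)
  have h5 : 2 ∣ p := by exact_mod_cast h4
  exact hp ((Nat.prime_dvd_prime_iff_eq Nat.prime_two Fact.out).1 h5).symm

/-! ### The quadratic Gauss sum and elements of modulus `p ^ (m / 2)`. -/

variable (p) in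
/-- The quadratic Gauss sum, as a cyclotomic integer. -/
def quadGauss : CycInt p :=
  gaussSum ((quadraticChar (ZMod p)).ringHomComp (Int.castRingHom (CycInt p))) (rootChar p)

theorem quadChar_intCast_ne_one (hp : p ≠ 2) :
    (quadraticChar (ZMod p)).ringHomComp (Int.castRingHom (CycInt p)) ≠ 1 := by
  intro h
  obtain ⟨a, ha⟩ := quadraticChar_exists_neg_one (F := ZMod p) (by rwa [ZMod.ringChar_zmod_n])
  have h1 := congrArg (fun χ => χ a) h
  have ha0 : a ≠ 0 := by rintro rfl; simp at ha
  rw [MulChar.one_apply (IsUnit.mk0 a ha0)] at h1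
  simp only [MulChar.ringHomComp_apply, ha] at h1
  norm_num at h1

theorem quadGauss_sq (hp : p ≠ 2) :
    quadGauss p ^ 2 = (quadraticChar (ZMod p) (-1) : ℤ) * (p : CycInt p) := by
  have := gaussSum_sq (quadChar_intCast_ne_one hp) ((quadraticChar_isQuadratic (ZMod p)).comp _)
    (rootChar_primitive p)
  rw [ZMod.card] at this
  exact this

theorem quadGauss_sq_eq_or (hp : p ≠ 2) :
    quadGauss p ^ 2 = p ∨ quadGauss p ^ 2 = -p := by
  rw [quadGauss_sq hp]
  rcases quadraticChar_dichotomy (F := ZMod p) (a := -1) (by simp) with h | h <;> simp [h]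

theorem galAut_quadGauss (a : (ZMod p)ˣ) :
    galAut p a (quadGauss p) = (quadraticChar (ZMod p) a : ℤ) * quadGauss p := by
  have h := gaussSum_mulShift ((quadraticChar (ZMod p)).ringHomComp (Int.castRingHom (CycInt p)))
    (rootChar p) a
  have h1 : galAut p a (quadGauss p) =
      gaussSum ((quadraticChar (ZMod p)).ringHomComp (Int.castRingHom (CycInt p)))
        ((rootChar p).mulShift a) := by
    simp only [quadGauss, gaussSum, map_sum, map_mul, galAut_rootChar, AddChar.mulShift_apply]
    refine Finset.sum_congr rfl fun x _ => ?_
    simp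
  rw [h1, quadGauss, ← h, ← mul_assoc]
  have h2 : ((quadraticChar (ZMod p) a : ℤ) : CycInt p) *
      ((quadraticChar (ZMod p)).ringHomComp (Int.castRingHom (CycInt p))) a = 1 := by
    have := quadraticChar_sq_one (F := ZMod p) a.ne_zero
    rw [MulChar.ringHomComp_apply, Int.coe_castRingHom, ← Int.cast_mul, ← sq, this, Int.cast_one]
  rw [h2, one_mul]

/-- Modulo 2 the quadratic character is 1 off zero, so the Gauss sum is congruent to the sum of `ζ ^
a` over `a ≠ 0`, which is `-1`. -/
theorem two_dvd_quadGauss_sub_one : (2 : CycInt p) ∣ quadGauss p - 1 := by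
  have h0 : ∑ a : ZMod p, rootChar p a = 0 :=
    AddChar.sum_eq_zero_of_ne_one (by simpa using rootChar_primitive p one_ne_zero)
  have h : quadGauss p - 1 = ∑ a : ZMod p,
      ((((quadraticChar (ZMod p) a : ℤ) : CycInt p) + 1) * rootChar p a - if a = 0 then 1 else 0) := by
    simp only [add_mul, one_mul, Finset.sum_sub_distrib, Finset.sum_add_distrib, h0,
      Finset.sum_ite_eq', Finset.mem_univ, if_true, add_zero]
    rfl
  rw [h]
  refine Finset.dvd_sum fun a _ => ?_
  rcases eq_or_ne a 0 with rfl | ha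
  · simp
  · rw [if_neg ha, sub_zero]
    refine Dvd.dvd.mul_right ?_ _
    rcases quadraticChar_dichotomy ha with h | h <;> simp [h, one_add_one_eq_two]

theorem associated_natCast_prime :
    Associated (p : CycInt p)
      (((zetaSpec p).toInteger - 1) ^ Module.finrank ℚ (CycField p)) := by
  have h0 : IsCyclotomicExtension {p ^ (0 + 1)} ℚ (CycField p) := by
    rw [zero_add, pow_one]; infer_instance
  have hζ : IsPrimitiveRoot (zeta p ℚ (CycField p)) (p ^ (0 + 1)) := by
    rw [zero_add, pow_one]; exact zetaSpec p
  have h := IsCyclotomicExtension.Rat.map_eq_span_zeta_sub_one_pow p 0 hζ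
  rw [Ideal.map_span, Set.image_singleton, Ideal.span_singleton_pow,
    Ideal.span_singleton_eq_span_singleton] at h
  simpa using h

theorem isCMField_cycField (hp : p ≠ 2) : IsCMField (CycField p) :=
  IsCyclotomicExtension.Rat.isCMField (S := {p}) (CycField p)
    ⟨p, rfl, lt_of_le_of_ne (Fact.out : p.Prime).two_le (Ne.symm hp)⟩

/-- In a CM field complex conjugation commutes with every embedding, so the norm condition at one
embedding is the ring identity `z * conj z = p ^ m`, valid at all of them. -/
theorem conj_mul_eq_of_norm (hp : p ≠ 2) {z : CycInt p} {m : ℕ}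
    (hz : ‖intEmb p z‖ ^ 2 = (p : ℝ) ^ m) :
    z ∣ (p : CycInt p) ^ m ∧ ∀ φ : CycField p →+* ℂ, ‖φ z‖ ^ 2 = (p : ℝ) ^ m := by
  have := isCMField_cycField hp
  have key : z * IsCMField.ringOfIntegersComplexConj (CycField p) z = (p : CycInt p) ^ m := by
    apply intEmb_injective p
    have h1 : intEmb p (IsCMField.ringOfIntegersComplexConj (CycField p) z) =
        (starRingEnd ℂ) (intEmb p z) :=
      IsCMField.complexEmbedding_complexConj (CycField p) (fieldEmb p : CycField p →+* ℂ) z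
    rw [map_mul, h1, Complex.mul_conj, Complex.normSq_eq_norm_sq, hz]
    simp
  refine ⟨⟨_, key.symm⟩, fun φ => ?_⟩
  have h2 := congrArg (fun w : CycInt p => φ w) key
  simp only [map_mul, map_pow, map_natCast, IsCMField.coe_ringOfIntegersComplexConj,
    IsCMField.complexEmbedding_complexConj, Complex.mul_conj, Complex.normSq_eq_norm_sq] at h2
  exact_mod_cast h2

/-- Kronecker's theorem makes `u` a root of unity, and for odd `p` the roots of unity of the field
are `± ζ ^ j`. -/
theorem eq_rootChar_of_norm_eq_one (hp : p ≠ 2) {u : CycInt p}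
    (hu : ∀ φ : CycField p →+* ℂ, ‖φ u‖ = 1) :
    ∃ j, u = rootChar p j ∨ u = -rootChar p j := by
  obtain ⟨n, hn, h⟩ := Embeddings.pow_eq_one_of_norm_eq_one (CycField p) ℂ u.isIntegral_coe hu
  obtain ⟨r, -, hr⟩ := (zetaSpec p).exists_pow_or_neg_mul_pow_of_isOfFinOrder
    ((Fact.out : p.Prime).odd_of_ne_two hp) (isOfFinOrder_iff_pow_eq_one.2 ⟨n, hn, h⟩)
  refine ⟨r, ?_⟩
  rw [rootChar_natCast]
  refine hr.imp (fun h => ?_) (fun h => ?_) <;>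
  · apply RingOfIntegers.coe_injective
    rw [h]
    simp
    rfl

/-- Cyclotomic integers with the same absolute value `p ^ (m / 2)` differ by a factor `±ζ ^ j`. -/
theorem eq_mul_rootChar_of_norm (hp : p ≠ 2) {z w : CycInt p} {m : ℕ}
    (hz : ‖intEmb p z‖ ^ 2 = (p : ℝ) ^ m) (hw : ‖intEmb p w‖ ^ 2 = (p : ℝ) ^ m) :
    ∃ j, z = w * rootChar p j ∨ z = -(w * rootChar p j) := by
  obtain ⟨hz1, hz2⟩ := conj_mul_eq_of_norm hp hz
  obtain ⟨hw1, hw2⟩ := conj_mul_eq_of_norm hp hw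
  have hpm : (p : ℝ) ^ m ≠ 0 := pow_ne_zero _ (by exact_mod_cast (Fact.out : p.Prime).ne_zero)
  have hunit : ∀ {z w u : CycInt p}, (∀ φ : CycField p →+* ℂ, ‖φ z‖ ^ 2 = (p : ℝ) ^ m) →
      (∀ φ : CycField p →+* ℂ, ‖φ w‖ ^ 2 = (p : ℝ) ^ m) → z = w * u →
      ∃ j, u = rootChar p j ∨ u = -rootChar p j := by
    intro z w u hz hw h
    refine eq_rootChar_of_norm_eq_one hp fun φ => ?_
    have h1 := hz φ
    rw [h, show ((w * u : CycInt p) : CycField p) = w * u from rfl, map_mul, norm_mul, mul_pow, hw φ] at h1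
    have h2 : ‖φ u‖ ^ 2 = 1 := by
      apply mul_left_cancel₀ hpm
      rw [h1, mul_one]
    exact (pow_eq_one_iff_of_nonneg (norm_nonneg _) two_ne_zero).1 h2
  -- Since `p` is totally ramified, every divisor of `p ^ m` is a power of the prime `ζ - 1` up to a
  -- unit. Hence one of `z`, `w` divides the other, and the quotient has modulus 1 at every
  -- embedding.
  have hassoc : ∀ {z : CycInt p}, z ∣ (p : CycInt p) ^ m →
      ∃ i, Associated z (((zetaSpec p).toInteger - 1) ^ i) := by
    intro z h
    have h1 := h.trans ((associated_natCast_prime (p := p)).pow_pow (n := m)).dvd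
    rw [← pow_mul] at h1
    obtain ⟨i, -, hi⟩ := (dvd_prime_pow (zetaSpec p).zeta_sub_one_prime' _).1 h1
    exact ⟨i, hi⟩
  obtain ⟨i, hi⟩ := hassoc hz1
  obtain ⟨k, hk⟩ := hassoc hw1
  rcases le_total k i with hik | hik
  · obtain ⟨u, hu⟩ := (hk.dvd.trans (pow_dvd_pow _ hik)).trans hi.symm.dvd
    obtain ⟨j, hj⟩ := hunit hz2 hw2 hu
    exact ⟨j, hj.imp (fun h => by rw [hu, h]) (fun h => by rw [hu, h, mul_neg])⟩
  · obtain ⟨u, hu⟩ := (hi.dvd.trans (pow_dvd_pow _ hik)).trans hk.symm.dvd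
    obtain ⟨j, hj⟩ := hunit hw2 hz2 hu
    have hjj : rootChar p j * rootChar p (-j) = 1 := by
      rw [← AddChar.map_add_eq_mul, add_neg_cancel, AddChar.map_zero_eq_one]
    refine ⟨-j, hj.imp (fun h => ?_) (fun h => ?_)⟩
    · rw [hu, h, mul_assoc, hjj, mul_one]
    · rw [hu, h, mul_neg, neg_mul, neg_neg, mul_assoc, hjj, mul_one]

theorem norm_intEmb_quadGauss_pow (hp : p ≠ 2) (m : ℕ) :
    ‖intEmb p (quadGauss p ^ m)‖ ^ 2 = (p : ℝ) ^ m := by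
  have h : ‖intEmb p (quadGauss p)‖ ^ 2 = p := by
    rw [← norm_pow, ← map_pow]
    rcases quadGauss_sq_eq_or hp with h | h <;> simp [h]
  rw [map_pow, norm_pow, ← pow_mul, mul_comm, pow_mul, h]

/-- Both sides have the same square, so the sign of the Gauss sum never has to be determined. -/
theorem intEmb_quadGauss_pow (hp : p ≠ 2) (m : ℕ) :
    intEmb p (quadGauss p ^ m) = (if p ^ m % 4 = 1 then 1 else Complex.I) * halfPow p m ∨
    intEmb p (quadGauss p ^ m) = -((if p ^ m % 4 = 1 then 1 else Complex.I) * halfPow p m) := by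
  rw [← sq_eq_sq_iff_eq_or_eq_neg, ← map_pow, ← pow_mul, mul_comm m 2, pow_mul, quadGauss_sq hp,
    quadraticChar_neg_one (by rwa [ZMod.ringChar_zmod_n]), ZMod.card, mul_pow, ← Int.cast_pow,
    ← map_pow, ← Nat.cast_pow, map_mul, map_intCast, mul_pow, ← Complex.ofReal_pow, halfPow,
    ← pow_mul, mul_comm m 2, pow_mul, Real.sq_sqrt (Nat.cast_nonneg p)]
  have hodd : p ^ m % 2 = 1 :=
    Nat.odd_iff.1 (((Fact.out : p.Prime).odd_of_ne_two hp).pow)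
  have h4 : p ^ m % 4 = 1 ∨ p ^ m % 4 = 3 := by omega
  rcases h4 with h | h
  · rw [ZMod.χ₄_nat_one_mod_four h]; simp [h]
  · rw [ZMod.χ₄_nat_three_mod_four h]; simp [h]

theorem two_dvd_quadGauss_pow_sub_one (m : ℕ) :
    (2 : CycInt p) ∣ quadGauss p ^ m - 1 := by
  have := (two_dvd_quadGauss_sub_one (p := p)).trans (sub_dvd_pow_sub_pow (quadGauss p) 1 m)
  rwa [one_pow] at this

/-- Squaring and using `g² = ± p` gives `p ^ (2r+1) ∣ p ^ (2r) * k²`: the extra half power of `p`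
already forces `p ∣ k`. -/
theorem dvd_of_quadGauss_pow_dvd (hp : p ≠ 2) {r : ℕ} {k : ℤ}
    (h : quadGauss p ^ (2 * r + 1) ∣ ((p : CycInt p)) ^ r * k) : (p : ℤ) ∣ k := by
  have h1 : ∀ m : ℕ, Associated ((quadGauss p ^ m) ^ 2) ((p : CycInt p) ^ m) := by
    intro m
    rw [← pow_mul, mul_comm m 2, pow_mul]
    apply Associated.pow_pow
    rcases quadGauss_sq_eq_or hp with h | h
    · rw [h]
      exact Associated.refl _
    · rw [h]
      exact (Associated.refl _).neg_left
  have h2 := (h1 _).symm.dvd.trans (pow_dvd_pow_of_dvd h 2)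
  have h3 : ((p ^ (2 * r + 1) : ℤ) : CycInt p) ∣ ((p ^ (2 * r) * k ^ 2 : ℤ) : CycInt p) := by
    push_cast
    rwa [mul_pow, ← pow_mul, mul_comm r 2] at h2
  have h4 := intCast_dvd_intCast p h3
  have hp0 : (p : ℤ) ^ (2 * r) ≠ 0 :=
    pow_ne_zero _ (by exact_mod_cast (Fact.out : p.Prime).ne_zero)
  rw [pow_succ, mul_dvd_mul_iff_left hp0] at h4
  exact (Nat.prime_iff_prime_int.1 Fact.out).dvd_of_dvd_pow h4

theorem quadGauss_dvd_natCast (hp : p ≠ 2) (m : ℕ) :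
    quadGauss p ^ (2 * m) ∣ (p : CycInt p) ^ m := by
  rw [pow_mul]
  apply pow_dvd_pow_of_dvd
  rcases quadGauss_sq_eq_or hp with h | h <;> rw [h]
  rw [neg_dvd]

end Cyclotomic

/-! ### Walsh transforms in the cyclotomic integers, and the dual function. -/

section Walsh

variable {p : ℕ} [Fact p.Prime] {V : Type*} [AddCommGroup V] [Module (ZMod p) V] [Fintype V]

theorem card_eq_pow_dim : Fintype.card V = p ^ dim p V := by
  rw [Module.card_eq_pow_finrank (K := ZMod p) (V := V), ZMod.card, dim]

theorem sum_rootChar_linear {l : V →ₗ[ZMod p] ZMod p} (hl : l ≠ 0) :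
    ∑ x, rootChar p (l x) = 0 := by
  refine AddChar.sum_eq_zero_of_ne_one (ψ := (rootChar p).compAddMonoidHom l.toAddMonoidHom) ?_
  intro h
  obtain ⟨x, hx⟩ : ∃ x, l x ≠ 0 := by
    by_contra! h0
    exact hl (LinearMap.ext h0)
  have h1 := rootChar_primitive p hx
  apply h1
  ext b
  have h2 := DFunLike.congr_fun h (b • x)
  simp only [AddChar.compAddMonoidHom_apply, LinearMap.toAddMonoidHom_coe, map_smul, smul_eq_mul,
    AddChar.one_apply] at h2
  rw [AddChar.mulShift_apply, mul_comm, h2, AddChar.one_apply]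

/-- The Walsh transform with values in the cyclotomic integers. -/
def intWalsh (B : LinearMap.BilinForm (ZMod p) V) (f : V → ZMod p) (α : V) : CycInt p :=
  ∑ x, rootChar p (f x - B α x)

variable {B : LinearMap.BilinForm (ZMod p) V} {s : ℕ} {f : V → ZMod p}

theorem intEmb_intWalsh (α : V) : intEmb p (intWalsh B f α) = walsh B f α := by
  simp [intWalsh, walsh, walshOn, intEmb_rootChar]

theorem sum_rootChar_bilin [DecidableEq V] (hnd : B.Nondegenerate) (x : V) :
    ∑ α, rootChar p (B α x) = if x = 0 then (p : CycInt p) ^ dim p V else 0 := by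
  split_ifs with h
  · simp [h, card_eq_pow_dim (p := p) (V := V)]
  · refine sum_rootChar_linear (l := B.flip x) fun h0 => h ?_
    exact hnd.2 x fun y => LinearMap.congr_fun h0 y

/-- Fourier inversion. -/
theorem sum_intWalsh_mul (hnd : B.Nondegenerate) (x : V) :
    ∑ α, intWalsh B f α * rootChar p (B α x) = (p : CycInt p) ^ dim p V * rootChar p (f x) := by
  classical
  calc ∑ α, intWalsh B f α * rootChar p (B α x)
      = ∑ α, ∑ y, rootChar p (f y) * rootChar p (B α (x - y)) := by
        refine Finset.sum_congr rfl fun α _ => ?_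
        rw [intWalsh, Finset.sum_mul]
        refine Finset.sum_congr rfl fun y _ => ?_
        rw [← AddChar.map_add_eq_mul, ← AddChar.map_add_eq_mul, map_sub]
        congr 1; ring
    _ = ∑ y, rootChar p (f y) * ∑ α, rootChar p (B α (x - y)) := by
        rw [Finset.sum_comm]
        simp only [Finset.mul_sum]
    _ = _ := by
        rw [Finset.sum_eq_single x]
        · rw [sum_rootChar_bilin hnd, if_pos (sub_self x), mul_comm]
        · intro y _ hy
          rw [sum_rootChar_bilin hnd, if_neg (sub_ne_zero.2 hy.symm), mul_zero]
        · simp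

/-- Parseval's identity, used to find the size of the Walsh support. -/
theorem sum_norm_walsh_sq (hnd : B.Nondegenerate) :
    ∑ α, ‖walsh B f α‖ ^ 2 = ((p : ℝ) ^ dim p V) ^ 2 := by
  have h : ∀ α, ((‖walsh B f α‖ ^ 2 : ℝ) : ℂ) =
      ∑ y, walsh B f α * ZMod.stdAddChar (B α y) * ZMod.stdAddChar (-f y) := by
    intro α
    rw [← Complex.normSq_eq_norm_sq, ← Complex.mul_conj]
    conv_lhs => rw [walsh, walshOn, map_sum, Finset.mul_sum]
    refine Finset.sum_congr rfl fun y _ => ?_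
    rw [conj_stdAddChar, mul_assoc, ← AddChar.map_add_eq_mul, walsh, walshOn]
    congr 2; ring
  have h1 : ∀ y, ∑ α, walsh B f α * ZMod.stdAddChar (B α y) =
      (p : ℂ) ^ dim p V * ZMod.stdAddChar (f y) := by
    intro y
    have := congrArg (intEmb p) (sum_intWalsh_mul (f := f) hnd y)
    simpa [intEmb_intWalsh, intEmb_rootChar] using this
  apply Complex.ofReal_injective
  rw [Complex.ofReal_sum, Finset.sum_congr rfl fun α _ => h α, Finset.sum_comm]
  simp only [← Finset.sum_mul, h1]
  simp only [mul_assoc, ← AddChar.map_add_eq_mul, add_neg_cancel, AddChar.map_zero_eq_one]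
  simp [card_eq_pow_dim (p := p) (V := V), sq]

theorem halfPow_sq (m : ℕ) : halfPow p m ^ 2 = (p : ℝ) ^ m := by
  rw [halfPow, ← pow_mul, mul_comm m 2, pow_mul, Real.sq_sqrt (Nat.cast_nonneg p)]

theorem mem_walshSupport {α : V} :
    α ∈ walshSupport B s f ↔ ‖walsh B f α‖ = halfPow p (dim p V + s) := by
  simp [walshSupport]

theorem walsh_eq_zero_of_notMem (hf : IsPlateaued B s f) {α : V} (h : α ∉ walshSupport B s f) :
    walsh B f α = 0 := by
  rw [mem_walshSupport] at h
  exact norm_eq_zero.1 ((hf.2 α).resolve_right h)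

theorem intWalsh_eq_zero_of_notMem (hf : IsPlateaued B s f) {α : V}
    (h : α ∉ walshSupport B s f) : intWalsh B f α = 0 := by
  apply intEmb_injective p
  rw [intEmb_intWalsh, walsh_eq_zero_of_notMem hf h, map_zero]

theorem card_walshSupport (hnd : B.Nondegenerate) (hf : IsPlateaued B s f) :
    (walshSupport B s f).card = p ^ (dim p V - s) := by
  have h : ∑ α, ‖walsh B f α‖ ^ 2 = (walshSupport B s f).card * (p : ℝ) ^ (dim p V + s) := by
    rw [← Finset.sum_subset (Finset.subset_univ (walshSupport B s f))
      fun α _ hα => by rw [walsh_eq_zero_of_notMem hf hα]; simp]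
    rw [Finset.sum_congr rfl fun α hα => by rw [mem_walshSupport.1 hα, halfPow_sq]]
    simp
  rw [sum_norm_walsh_sq hnd] at h
  have hp0 : (p : ℝ) ≠ 0 := by exact_mod_cast (Fact.out : p.Prime).ne_zero
  have h1 : ((p : ℝ) ^ dim p V) ^ 2 = (p : ℝ) ^ (dim p V - s) * (p : ℝ) ^ (dim p V + s) := by
    rw [← pow_mul, ← pow_add]
    congr 1
    have := hf.1
    omega
  rw [h1] at h
  have h2 := mul_right_cancel₀ (pow_ne_zero _ hp0) h
  exact_mod_cast h2.symm

/-- The exponents differ by `2s` and `p² ≡ 1 (mod 4)`; this is why the same `μ` serves for `f` and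
for `f*`. -/
theorem pow_add_mod_four (hp : p ≠ 2) (hs : s ≤ dim p V) :
    p ^ (dim p V + s) % 4 = p ^ (dim p V - s) % 4 := by
  have h : dim p V + s = (dim p V - s) + 2 * s := by omega
  have hodd := Nat.odd_iff.1 ((Fact.out : p.Prime).odd_of_ne_two hp)
  have h2 : p ^ 2 % 4 = 1 := by
    have : p % 4 = 1 ∨ p % 4 = 3 := by omega
    rcases this with h | h <;> simp [Nat.pow_mod, h]
  rw [h, pow_add, pow_mul, Nat.mul_mod, Nat.pow_mod (p ^ 2), h2]
  simp

theorem intEmb_quadGauss_pow_add (hp : p ≠ 2) :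
    intEmb p (quadGauss p ^ (dim p V + s)) = mu p V s * halfPow p (dim p V + s) ∨
    intEmb p (quadGauss p ^ (dim p V + s)) = -(mu p V s * halfPow p (dim p V + s)) :=
  intEmb_quadGauss_pow hp _

theorem intEmb_quadGauss_pow_sub (hp : p ≠ 2) (hs : s ≤ dim p V) :
    intEmb p (quadGauss p ^ (dim p V - s)) = mu p V s * halfPow p (dim p V - s) ∨
    intEmb p (quadGauss p ^ (dim p V - s)) = -(mu p V s * halfPow p (dim p V - s)) := by
  rw [mu, pow_add_mod_four hp hs]
  exact intEmb_quadGauss_pow hp _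

/-- On the Walsh support the default branch of `dual` is never taken: the Walsh value and `g ^ (n +
s)` have the same modulus, so they differ by some `± ζ ^ j`. -/
theorem walsh_eq_dual (hp : p ≠ 2) {α : V} (h : α ∈ walshSupport B s f) :
    walsh B f α = mu p V s * halfPow p (dim p V + s) * ZMod.stdAddChar (dual B s f α) ∨
    walsh B f α = -(mu p V s * halfPow p (dim p V + s) * ZMod.stdAddChar (dual B s f α)) := by
  have hex : ∃ j : ZMod p,
      walsh B f α = mu p V s * halfPow p (dim p V + s) * ZMod.stdAddChar j ∨
      walsh B f α = -(mu p V s * halfPow p (dim p V + s) * ZMod.stdAddChar j) := by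
    have h1 : ‖intEmb p (intWalsh B f α)‖ ^ 2 = (p : ℝ) ^ (dim p V + s) := by
      rw [intEmb_intWalsh, mem_walshSupport.1 h, halfPow_sq]
    obtain ⟨j, hj⟩ := eq_mul_rootChar_of_norm hp h1 (norm_intEmb_quadGauss_pow hp _)
    refine ⟨j, ?_⟩
    rw [← intEmb_intWalsh, ← intEmb_rootChar]
    rcases intEmb_quadGauss_pow_add (V := V) (s := s) hp with hg | hg <;>
    rcases hj with hj | hj <;> rw [hj] <;>
      simp only [map_neg, map_mul, hg, neg_mul, neg_neg, true_or, or_true]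
  rw [dual, dif_pos hex]
  exact hex.choose_spec

theorem intWalsh_eq_dual (hp : p ≠ 2) {α : V} (h : α ∈ walshSupport B s f) :
    intWalsh B f α = quadGauss p ^ (dim p V + s) * rootChar p (dual B s f α) ∨
    intWalsh B f α = -(quadGauss p ^ (dim p V + s) * rootChar p (dual B s f α)) := by
  rw [← (intEmb_injective p).eq_iff, ← (intEmb_injective p).eq_iff, map_neg, map_mul,
    intEmb_intWalsh, intEmb_rootChar]
  rcases intEmb_quadGauss_pow_add (V := V) (s := s) hp with hg | hg <;>
  rcases walsh_eq_dual hp h with hj | hj <;> rw [hg, hj] <;> simp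

theorem two_dvd_sub_rootChar {z : CycInt p} {m : ℕ} {j : ZMod p}
    (h : z = quadGauss p ^ m * rootChar p j ∨ z = -(quadGauss p ^ m * rootChar p j)) :
    (2 : CycInt p) ∣ z - rootChar p j := by
  obtain ⟨c, hc⟩ := two_dvd_quadGauss_pow_sub_one (p := p) m
  rw [sub_eq_iff_eq_add] at hc
  rcases h with h | h
  · exact ⟨c * rootChar p j, by rw [h, hc]; ring⟩
  · exact ⟨-c * rootChar p j - rootChar p j, by rw [h, hc]; ring⟩

/-- Signs and powers of `g` are trivial mod 2, so the residue mod 2 determines the exponent of `ζ`.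
-/
theorem eq_of_two_dvd_sub (hp : p ≠ 2) {z w : CycInt p} {m l : ℕ} {j k : ZMod p}
    (hz : z = quadGauss p ^ m * rootChar p j ∨ z = -(quadGauss p ^ m * rootChar p j))
    (hw : w = quadGauss p ^ l * rootChar p k ∨ w = -(quadGauss p ^ l * rootChar p k))
    (h : (2 : CycInt p) ∣ z - w) : j = k := by
  apply eq_of_two_dvd_rootChar_sub hp
  have h1 := (h.sub (two_dvd_sub_rootChar hz)).add (two_dvd_sub_rootChar hw)
  convert h1 using 1
  ring

theorem natCast_pow_eq_quadGauss_pow (hp : p ≠ 2) (m : ℕ) :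
    (p : CycInt p) ^ m = quadGauss p ^ (2 * m) ∨ (p : CycInt p) ^ m = -quadGauss p ^ (2 * m) := by
  rw [pow_mul]
  rcases quadGauss_sq_eq_or hp with h | h
  · simp [h]
  · rw [h, neg_pow]
    rcases neg_one_pow_eq_or (CycInt p) m with h | h <;> simp [h]

theorem quadGauss_ne_zero (hp : p ≠ 2) : quadGauss p ≠ 0 := by
  intro h
  have := norm_intEmb_quadGauss_pow hp 1
  rw [h] at this
  simp at this
  exact (Fact.out : p.Prime).ne_zero (by exact_mod_cast this.symm)

/-- Bentness of `f*` gives its transform `z₁` at `x` the form `± g ^ (n - s) ζ ^ j`, with `j`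
unknown. The signed sum `z₂` is known by inversion and has exponent `f (-x)`. The two agree mod 2,
so `j = f (-x)`. -/
theorem mem_dualBPlus_or_mem_dualBMinus (hp : p ≠ 2) (hsymm : B.IsSymm) (hnd : B.Nondegenerate)
    (hf : IsPlateaued B s f) (hd : IsBentRelative B (walshSupport B s f) (dual B s f)) (x : V) :
    x ∈ dualBPlus B s f ∨ x ∈ dualBMinus B s f := by
  classical
  set S := walshSupport B s f with hS
  set z₁ : CycInt p := ∑ α ∈ S, rootChar p (dual B s f α - B x α) with hz₁
  have hz₁w : intEmb p z₁ = walshOn B S (dual B s f) x := by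
    simp [hz₁, walshOn, intEmb_rootChar]
  have hz₁n : ‖intEmb p z₁‖ ^ 2 = (p : ℝ) ^ (dim p V - s) := by
    rw [hz₁w, hd x, Real.sq_sqrt (Nat.cast_nonneg _), card_walshSupport hnd hf]
    push_cast; rfl
  obtain ⟨j, hj⟩ := eq_mul_rootChar_of_norm hp hz₁n (norm_intEmb_quadGauss_pow hp _)
  have hsign : ∀ α, ∃ e : CycInt p, (e = 1 ∨ e = -1) ∧ (α ∈ S →
      intWalsh B f α = quadGauss p ^ (dim p V + s) * (e * rootChar p (dual B s f α))) := by
    intro α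
    by_cases hα : α ∈ S
    · rcases intWalsh_eq_dual hp hα with h | h
      · exact ⟨1, Or.inl rfl, fun _ => by rw [h, one_mul]⟩
      · exact ⟨-1, Or.inr rfl, fun _ => by rw [h]; ring⟩
    · exact ⟨1, Or.inl rfl, fun h => absurd h hα⟩
  choose e he1 he2 using hsign
  set z₂ : CycInt p := ∑ α ∈ S, e α * rootChar p (dual B s f α - B x α) with hz₂
  have h12 : (2 : CycInt p) ∣ z₁ - z₂ := by
    rw [hz₁, hz₂, ← Finset.sum_sub_distrib]
    refine Finset.dvd_sum fun α _ => ?_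
    rcases he1 α with h | h
    · simp [h]
    · exact ⟨rootChar p (dual B s f α - B x α), by rw [h]; ring⟩
  -- Fourier inversion at `-x`, with each Walsh value written as `g ^ (n + s)` times its sign times
  -- `ζ ^ f*(α)`.
  have hinv : quadGauss p ^ (dim p V + s) * z₂ =
      (p : CycInt p) ^ dim p V * rootChar p (f (-x)) := by
    rw [← sum_intWalsh_mul hnd, ← Finset.sum_subset (Finset.subset_univ S)
      fun α _ hα => by rw [intWalsh_eq_zero_of_notMem hf hα, zero_mul], hz₂, Finset.mul_sum]
    refine Finset.sum_congr rfl fun α hα => ?_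
    rw [he2 α hα, map_neg, mul_assoc, mul_assoc, ← AddChar.map_add_eq_mul, ← sub_eq_add_neg,
      hsymm.eq x α]
  have hz₂g : z₂ = quadGauss p ^ (dim p V - s) * rootChar p (f (-x)) ∨
      z₂ = -(quadGauss p ^ (dim p V - s) * rootChar p (f (-x))) := by
    have hg0 := pow_ne_zero (dim p V + s) (quadGauss_ne_zero hp)
    have hpow : quadGauss p ^ (2 * dim p V) =
        quadGauss p ^ (dim p V + s) * quadGauss p ^ (dim p V - s) := by
      rw [← pow_add]
      congr 1
      have := hf.1
      omega
    rcases natCast_pow_eq_quadGauss_pow hp (dim p V) with h | h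
    · left
      apply mul_left_cancel₀ hg0
      rw [hinv, h, hpow, mul_assoc]
    · right
      apply mul_left_cancel₀ hg0
      rw [hinv, h, hpow]; ring
  have hjf := eq_of_two_dvd_sub hp hj hz₂g h12
  subst hjf
  have goal : walshOn B S (dual B s f) x =
        mu p V s * halfPow p (dim p V - s) * ZMod.stdAddChar (f (-x)) ∨
      walshOn B S (dual B s f) x =
        -(mu p V s * halfPow p (dim p V - s) * ZMod.stdAddChar (f (-x))) := by
    rw [← hz₁w, ← intEmb_rootChar]
    rcases intEmb_quadGauss_pow_sub (V := V) (s := s) hp hf.1 with hg | hg <;>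
    rcases hj with hj | hj <;> rw [hj] <;>
      simp only [map_neg, map_mul, hg, neg_mul, neg_neg, true_or, or_true]
  exact goal

end Walsh

/-! ### Homogeneity of `f`, its Walsh value at 0, and fibre counts. -/

section Form

variable {p : ℕ} [Fact p.Prime] {V : Type*} [AddCommGroup V] [Module (ZMod p) V] [Fintype V]
  {B : LinearMap.BilinForm (ZMod p) V} {s : ℕ} {f : V → ZMod p}

theorem exists_form_exponent (hp : p ≠ 2) (hsymm : B.IsSymm) (hnd : B.Nondegenerate)
    (hf : MemF B s f) (x : V) :
    ∃ t : ℕ, 2 ≤ t ∧ Nat.Coprime (t - 1) (p - 1) ∧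
      ∀ a : ZMod p, a ≠ 0 → f (a • x) = a ^ t * f x := by
  rcases mem_dualBPlus_or_mem_dualBMinus hp hsymm hnd hf.plateaued hf.dual_bent x with h | h
  · obtain ⟨t, h2, -, hg, ht⟩ := hf.form_plus
    exact ⟨t, h2, hg, fun a ha => ht a ha x h⟩
  · obtain ⟨t, h2, -, hg, ht⟩ := hf.form_minus
    exact ⟨t, h2, hg, fun a ha => ht a ha x h⟩

/-- The exponent `t` is even, because `t - 1` is coprime to the even number `p - 1`. -/
theorem apply_neg (hp : p ≠ 2) (hsymm : B.IsSymm) (hnd : B.Nondegenerate)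
    (hf : MemF B s f) (x : V) : f (-x) = f x := by
  obtain ⟨t, h2, hg, ht⟩ := exists_form_exponent hp hsymm hnd hf x
  have hpe : 2 ∣ p - 1 := ((Fact.out : p.Prime).even_sub_one hp).two_dvd
  have ho : Nat.Coprime (t - 1) 2 := hg.coprime_dvd_right hpe
  rw [Nat.coprime_two_right] at ho
  have he : Even t := by
    have : t = t - 1 + 1 := by omega
    rw [this]
    exact ho.add_one
  have := ht (-1) (by simp)
  rwa [neg_smul, one_smul, he.neg_one_pow, one_mul] at this

theorem apply_smul_ne_zero (hp : p ≠ 2) (hsymm : B.IsSymm) (hnd : B.Nondegenerate)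
    (hf : MemF B s f) {a : ZMod p} (ha : a ≠ 0) (x : V) : f (a • x) ≠ 0 ↔ f x ≠ 0 := by
  obtain ⟨t, -, -, ht⟩ := exists_form_exponent hp hsymm hnd hf x
  rw [ht a ha]
  simp [ha]

/-- Here `a ^ (t - 1) = 1` and `a ^ (p - 1) = 1`, with coprime exponents. This is what excludes dual
words of weight 2. -/
theorem eq_one_of_apply_smul (hp : p ≠ 2) (hsymm : B.IsSymm) (hnd : B.Nondegenerate)
    (hf : MemF B s f) {a : ZMod p} (ha : a ≠ 0) {x : V} (hx : f x ≠ 0)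
    (h : f (a • x) = a * f x) : a = 1 := by
  obtain ⟨t, h2, hg, ht⟩ := exists_form_exponent hp hsymm hnd hf x
  rw [ht a ha] at h
  have h1 := mul_right_cancel₀ hx h
  have h3 : a ^ (t - 1) = 1 := by
    apply mul_right_cancel₀ ha
    rw [← pow_succ, one_mul, show t - 1 + 1 = t by omega, h1]
  have h4 := ZMod.pow_card_sub_one_eq_one ha
  have h5 := pow_gcd_eq_one.2 ⟨h3, h4⟩
  rwa [hg, pow_one] at h5

theorem two_ne_zero_zmod (hp : p ≠ 2) : (2 : ZMod p) ≠ 0 := by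
  have : ((2 : ℕ) : ZMod p) ≠ 0 := by
    rw [Ne, ZMod.natCast_eq_zero_iff]
    exact fun h => hp ((Nat.prime_dvd_prime_iff_eq Fact.out Nat.prime_two).1 h)
  exact_mod_cast this

theorem ne_neg_self (hp : p ≠ 2) {x : V} (hx : x ≠ 0) : -x ≠ x := by
  intro h
  have h2 : (2 : ZMod p) • x = 0 := by
    rw [two_smul]
    nth_rw 1 [← h]
    exact neg_add_cancel x
  exact hx ((smul_eq_zero.1 h2).resolve_left (two_ne_zero_zmod hp))

/-- The terms at `x` and `-x` are equal and cancel mod 2, leaving only the term at 0. It follows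
that the Walsh value at 0 is nonzero and that its exponent is 0. -/
theorem two_dvd_intWalsh_zero_sub_one (hp : p ≠ 2) (hf0 : f 0 = 0) (hev : ∀ x, f (-x) = f x) :
    (2 : CycInt p) ∣ intWalsh B f 0 - 1 := by
  classical
  have h : intWalsh B f 0 - 1 = ∑ x ∈ Finset.univ.erase (0 : V), rootChar p (f x) := by
    rw [intWalsh, ← Finset.add_sum_erase _ _ (Finset.mem_univ (0 : V))]
    simp [hf0]
  rw [h, ← Ideal.mem_span_singleton, ← Ideal.Quotient.eq_zero_iff_mem, map_sum]
  refine Finset.sum_involution (fun x _ => -x) ?_ ?_ ?_ ?_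
  · intro x _
    rw [hev, ← map_add, ← two_mul, Ideal.Quotient.eq_zero_iff_mem, Ideal.mem_span_singleton]
    exact dvd_mul_right _ _
  · intro x hx _
    exact ne_neg_self hp (Finset.ne_of_mem_erase hx)
  · intro x hx
    simpa using hx
  · intro x _
    exact neg_neg x

theorem zero_mem_walshSupport (hp : p ≠ 2) (hpl : IsPlateaued B s f) (hf0 : f 0 = 0)
    (hev : ∀ x, f (-x) = f x) : (0 : V) ∈ walshSupport B s f := by
  by_contra h
  have h1 := two_dvd_intWalsh_zero_sub_one (B := B) hp hf0 hev
  rw [intWalsh_eq_zero_of_notMem hpl h, zero_sub, dvd_neg] at h1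
  have h2 : (2 : ℤ) ∣ 1 := intCast_dvd_intCast p (by exact_mod_cast h1)
  norm_num at h2

theorem dual_zero (hp : p ≠ 2) (hpl : IsPlateaued B s f) (hf0 : f 0 = 0)
    (hev : ∀ x, f (-x) = f x) : dual B s f 0 = 0 := by
  have h0 : (1 : CycInt p) = quadGauss p ^ 0 * rootChar p 0 := by simp
  refine eq_of_two_dvd_sub hp (intWalsh_eq_dual hp (zero_mem_walshSupport hp hpl hf0 hev))
    (Or.inl h0) (two_dvd_intWalsh_zero_sub_one hp hf0 hev)

theorem intWalsh_zero_eq (hp : p ≠ 2) (hpl : IsPlateaued B s f) (hf0 : f 0 = 0)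
    (hev : ∀ x, f (-x) = f x) :
    intWalsh B f 0 = quadGauss p ^ (dim p V + s) ∨
    intWalsh B f 0 = -quadGauss p ^ (dim p V + s) := by
  have := intWalsh_eq_dual hp (zero_mem_walshSupport hp hpl hf0 hev)
  rwa [dual_zero hp hpl hf0 hev, AddChar.map_zero_eq_one, mul_one] at this

theorem eps_zero (hp : p ≠ 2) (hpl : IsPlateaued B s f) (hf0 : f 0 = 0)
    (hev : ∀ x, f (-x) = f x) :
    (eps B s f 0 = 1 ∨ eps B s f 0 = -1) ∧
      walsh B f 0 = eps B s f 0 * (mu p V s * halfPow p (dim p V + s)) := by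
  have hS := zero_mem_walshSupport hp hpl hf0 hev
  have h := walsh_eq_dual hp hS
  have hd := dual_zero hp hpl hf0 hev
  by_cases h1 : (0 : V) ∈ BPlus B s f
  · rw [eps, if_pos h1]
    refine ⟨Or.inl rfl, ?_⟩
    rw [h1.2, hd]
    simp
  · have h2 : (0 : V) ∈ BMinus B s f := ⟨hS, h.resolve_left fun h' => h1 ⟨hS, h'⟩⟩
    rw [eps, if_neg h1, if_pos h2]
    refine ⟨Or.inr rfl, ?_⟩
    rw [h2.2, hd]
    simp

theorem sum_rootChar_mul (h : V → ZMod p) (a : (ZMod p)ˣ) :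
    ∑ x, rootChar p (a * h x) = galAut p a (∑ x, rootChar p (h x)) := by
  simp [galAut_rootChar]

theorem natCast_mul_card_fiber (h : V → ZMod p) (c : ZMod p) :
    (p : CycInt p) * (Finset.univ.filter fun x => h x = c).card =
      ∑ a : ZMod p, rootChar p (-(a * c)) * ∑ x, rootChar p (a * h x) := by
  have h1 : ∀ x, (if h x = c then (p : CycInt p) else 0) =
      ∑ a : ZMod p, rootChar p (a * (h x - c)) := by
    intro x
    rw [AddChar.sum_mulShift _ (rootChar_primitive p), ZMod.card]
    simp [sub_eq_zero]
  have h2 : (p : CycInt p) * (Finset.univ.filter fun x => h x = c).card =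
      ∑ x, if h x = c then (p : CycInt p) else 0 := by
    rw [← Finset.sum_filter, Finset.sum_const, nsmul_eq_mul, mul_comm]
  rw [h2, Finset.sum_congr rfl fun x _ => h1 x, Finset.sum_comm]
  refine Finset.sum_congr rfl fun a _ => ?_
  rw [Finset.mul_sum]
  refine Finset.sum_congr rfl fun x _ => ?_
  rw [← AddChar.map_add_eq_mul]
  congr 1; ring

/-- The Walsh value at 0 is an odd power of `g` up to sign, so the conjugation `ζ ↦ ζ ^ a`
multiplies it by the quadratic character of `a`; these contributions sum to zero. -/
theorem card_zero_fiber_of_odd (hp : p ≠ 2) (hpl : IsPlateaued B s f) (hf0 : f 0 = 0)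
    (hev : ∀ x, f (-x) = f x) (hodd : Odd (dim p V + s)) :
    p * (Finset.univ.filter fun x => f x = 0).card = p ^ dim p V := by
  have h0 := natCast_mul_card_fiber f 0
  have h1 : ∀ a : ZMod p, rootChar p (-(a * 0)) * ∑ x, rootChar p (a * f x) =
      (quadraticChar (ZMod p) a : ℤ) * intWalsh B f 0 +
        if a = 0 then (p : CycInt p) ^ dim p V else 0 := by
    intro a
    rcases eq_or_ne a 0 with rfl | ha
    · simp [card_eq_pow_dim (p := p) (V := V)]
    · have h2 := sum_rootChar_mul f (Units.mk0 a ha)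
      have h3 : intWalsh B f 0 = ∑ x, rootChar p (f x) := by simp [intWalsh]
      rw [Units.val_mk0, ← h3] at h2
      have h4 : galAut p (Units.mk0 a ha) (quadGauss p ^ (dim p V + s)) =
          (quadraticChar (ZMod p) a : ℤ) * quadGauss p ^ (dim p V + s) := by
        rw [map_pow, galAut_quadGauss, mul_pow, Units.val_mk0]
        congr 1
        rcases quadraticChar_dichotomy ha with h | h <;> simp [h, hodd.neg_one_pow]
      rw [h2, if_neg ha, add_zero, mul_zero, neg_zero, AddChar.map_zero_eq_one, one_mul]
      rcases intWalsh_zero_eq hp hpl hf0 hev with h | h <;> rw [h]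
      · exact h4
      · rw [map_neg, h4, mul_neg]
  rw [Finset.sum_congr rfl fun a _ => h1 a, Finset.sum_add_distrib, ← Finset.sum_mul,
    ← Int.cast_sum, quadraticChar_sum_zero (by rwa [ZMod.ringChar_zmod_n])] at h0
  simp only [Int.cast_zero, zero_mul, zero_add, Finset.sum_ite_eq', Finset.mem_univ, if_true] at h0
  exact_mod_cast h0

/-- Here the Walsh value at 0 is a rational integer, fixed by Galois, so each of the `p - 1` nonzero
`a` contributes it once. -/
theorem card_zero_fiber_of_even (hp : p ≠ 2) (hpl : IsPlateaued B s f) (hf0 : f 0 = 0)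
    (hev : ∀ x, f (-x) = f x) (heven : Even (dim p V + s)) :
    (p : ℤ) * (Finset.univ.filter fun x => f x = 0).card =
      p ^ dim p V + (p - 1) * eps B s f 0 * p ^ ((dim p V + s) / 2) := by
  have hw : intWalsh B f 0 = ((eps B s f 0 * p ^ ((dim p V + s) / 2) : ℤ) : CycInt p) := by
    apply intEmb_injective p
    rw [intEmb_intWalsh, (eps_zero hp hpl hf0 hev).2, map_intCast]
    obtain ⟨k, hk⟩ := heven
    rw [← two_mul] at hk
    have hmod : p ^ (2 * k) % 4 = 1 := by
      have hodd := Nat.odd_iff.1 ((Fact.out : p.Prime).odd_of_ne_two hp)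
      have h2 : p ^ 2 % 4 = 1 := by
        have : p % 4 = 1 ∨ p % 4 = 3 := by omega
        rcases this with h | h <;> simp [Nat.pow_mod, h]
      rw [pow_mul, Nat.pow_mod, h2]
      simp
    rw [mu, halfPow, hk, if_pos hmod, pow_mul, Real.sq_sqrt (Nat.cast_nonneg p)]
    simp
  have h0 := natCast_mul_card_fiber f 0
  have h1 : ∀ a : ZMod p, rootChar p (-(a * 0)) * ∑ x, rootChar p (a * f x) =
      intWalsh B f 0 +
        if a = 0 then (p : CycInt p) ^ dim p V - intWalsh B f 0 else 0 := by
    intro a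
    rcases eq_or_ne a 0 with rfl | ha
    · simp [card_eq_pow_dim (p := p) (V := V)]
    · have h2 := sum_rootChar_mul f (Units.mk0 a ha)
      have h3 : intWalsh B f 0 = ∑ x, rootChar p (f x) := by simp [intWalsh]
      rw [Units.val_mk0, ← h3] at h2
      rw [h2, if_neg ha, add_zero, mul_zero, neg_zero, AddChar.map_zero_eq_one, one_mul, hw,
        map_intCast]
  rw [Finset.sum_congr rfl fun a _ => h1 a, Finset.sum_add_distrib, Finset.sum_const, hw,
    Finset.card_univ, ZMod.card] at h0
  simp only [Finset.sum_ite_eq', Finset.mem_univ, if_true, nsmul_eq_mul] at h0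
  have h5 : (p : ℤ) * (Finset.univ.filter fun x => f x = 0).card =
      p * (eps B s f 0 * p ^ ((dim p V + s) / 2)) +
        (p ^ dim p V - eps B s f 0 * p ^ ((dim p V + s) / 2)) := by exact_mod_cast h0
  rw [h5]; ring

theorem quadGauss_pow_dvd_intWalsh (hp : p ≠ 2) (hpl : IsPlateaued B s f) (α : V) :
    quadGauss p ^ (dim p V + s) ∣ intWalsh B f α := by
  by_cases h : α ∈ walshSupport B s f
  · rcases intWalsh_eq_dual hp h with h | h <;> rw [h]
    · exact dvd_mul_right _ _
    · exact (dvd_mul_right _ _).neg_right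
  · rw [intWalsh_eq_zero_of_notMem hpl h]
    exact dvd_zero _

/-- The sum is a Galois conjugate of a Walsh value, and the conjugates of `g` are `± g`. -/
theorem quadGauss_pow_dvd_sum (hp : p ≠ 2) (hpl : IsPlateaued B s f) {a : ZMod p} (ha : a ≠ 0)
    (β : V) : quadGauss p ^ (dim p V + s) ∣ ∑ x, rootChar p (a * f x + B β x) := by
  have h := sum_rootChar_mul (fun x => f x - B (-(a⁻¹ • β)) x) (Units.mk0 a ha)
  have h1 := map_dvd (galAut p (Units.mk0 a ha))
    (quadGauss_pow_dvd_intWalsh hp hpl (-(a⁻¹ • β)))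
  rw [intWalsh, ← h, map_pow, galAut_quadGauss, mul_pow] at h1
  convert dvd_of_mul_left_dvd h1 using 4 with x
  simp only [Units.val_mk0, map_neg, map_smul, LinearMap.neg_apply, LinearMap.smul_apply,
    smul_eq_mul]
  field_simp
  ring

/-- Detecting the fibre costs one factor `p`, that is `g²`; since `g³` divides every character sum,
half a power of `p` is left over. -/
theorem dvd_card_fiber (hp : p ≠ 2) (hpl : IsPlateaued B s f) (h3 : 3 ≤ dim p V + s)
    (c : ZMod p) : p ∣ (Finset.univ.filter fun x => f x = c).card := by
  have h : (p : ℤ) ∣ ((Finset.univ.filter fun x => f x = c).card : ℤ) := by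
    refine dvd_of_quadGauss_pow_dvd hp (r := 1) ?_
    rw [pow_one, Int.cast_natCast, natCast_mul_card_fiber]
    refine Finset.dvd_sum fun a _ => Dvd.dvd.mul_left ?_ _
    rcases eq_or_ne a 0 with rfl | ha
    · have h1 : ∑ x : V, rootChar p (0 * f x) = (p : CycInt p) ^ dim p V := by
        simp [card_eq_pow_dim (p := p) (V := V)]
      rw [h1]
      refine dvd_trans (pow_dvd_pow _ ?_) (quadGauss_dvd_natCast hp _)
      have := hpl.1
      omega
    · have h1 := quadGauss_pow_dvd_sum (B := B) hp hpl ha 0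
      simp only [map_zero, LinearMap.zero_apply, add_zero] at h1
      exact (pow_dvd_pow _ h3).trans h1
  exact_mod_cast h

/-- Two conditions cost `p²`, that is `g⁴`, hence the bound 5 in place of 3. -/
theorem dvd_card_joint_fiber (hp : p ≠ 2) (hnd : B.Nondegenerate) (hpl : IsPlateaued B s f)
    (h5 : 5 ≤ dim p V + s) {b : V} (hb : b ≠ 0) (c d : ZMod p) :
    p ∣ (Finset.univ.filter fun x => f x = c ∧ B b x = d).card := by
  have hcard : (p : CycInt p) ^ 2 *
      (Finset.univ.filter fun x => f x = c ∧ B b x = d).card =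
      ∑ a : ZMod p, ∑ e : ZMod p, rootChar p (-(a * c) - e * d) *
        ∑ x, rootChar p (a * f x + B (e • b) x) := by
    have h1 : ∀ x, (if f x = c ∧ B b x = d then (p : CycInt p) ^ 2 else 0) =
        (∑ a : ZMod p, rootChar p (a * (f x - c))) *
          ∑ e : ZMod p, rootChar p (e * (B b x - d)) := by
      intro x
      rw [AddChar.sum_mulShift _ (rootChar_primitive p),
        AddChar.sum_mulShift _ (rootChar_primitive p), ZMod.card]
      simp only [sub_eq_zero]
      by_cases h1 : f x = c <;> by_cases h2 : B b x = d <;> simp [h1, h2, sq]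
    have h2 : (p : CycInt p) ^ 2 * (Finset.univ.filter fun x => f x = c ∧ B b x = d).card =
        ∑ x, if f x = c ∧ B b x = d then (p : CycInt p) ^ 2 else 0 := by
      rw [← Finset.sum_filter, Finset.sum_const, nsmul_eq_mul, mul_comm]
    rw [h2, Finset.sum_congr rfl fun x _ => h1 x]
    simp only [Finset.sum_mul_sum]
    simp only [Finset.mul_sum, ← AddChar.map_add_eq_mul]
    rw [Finset.sum_comm]
    refine Finset.sum_congr rfl fun a _ => ?_
    rw [Finset.sum_comm]
    refine Finset.sum_congr rfl fun e _ => Finset.sum_congr rfl fun x _ => ?_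
    congr 1
    simp only [map_smul, LinearMap.smul_apply, smul_eq_mul]
    ring
  have h : (p : ℤ) ∣ ((Finset.univ.filter fun x => f x = c ∧ B b x = d).card : ℤ) := by
    refine dvd_of_quadGauss_pow_dvd hp (r := 2) ?_
    rw [Int.cast_natCast, hcard]
    refine Finset.dvd_sum fun a _ => Finset.dvd_sum fun e _ => Dvd.dvd.mul_left ?_ _
    rcases eq_or_ne a 0 with rfl | ha
    · rcases eq_or_ne e 0 with rfl | he
      · have h1 : ∑ x : V, rootChar p (0 * f x + B ((0 : ZMod p) • b) x) =
            (p : CycInt p) ^ dim p V := by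
          simp [card_eq_pow_dim (p := p) (V := V)]
        rw [h1]
        refine dvd_trans (pow_dvd_pow _ ?_) (quadGauss_dvd_natCast hp _)
        have := hpl.1
        omega
      · have h1 : ∑ x : V, rootChar p (0 * f x + B (e • b) x) = 0 := by
          simp only [zero_mul, zero_add]
          refine sum_rootChar_linear fun h0 => ?_
          have h2 : e • b = 0 := hnd.1 _ fun y => by rw [h0, LinearMap.zero_apply]
          exact (smul_ne_zero he hb) h2
        rw [h1]
        exact dvd_zero _
    · exact (pow_dvd_pow _ h5).trans (quadGauss_pow_dvd_sum hp hpl ha _)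
  exact_mod_cast h

end Form

/-! ### Dual codes and the code generated by `[I, G]`. -/

section LinearCodes

open Matrix

variable {p : ℕ} [Fact p.Prime] {k ι : Type*} [Fintype k] [DecidableEq k] [Fintype ι]

theorem dualCode_eq_orthogonal (C : Submodule (ZMod p) (ι → ZMod p)) :
    dualCode C = LinearMap.BilinForm.orthogonal (dotProductBilin (ZMod p) (ZMod p)) C := by
  ext x
  exact forall₂_congr fun y _ => by rw [dotProduct_comm]; rfl

theorem dotProductBilin_nondegenerate :
    LinearMap.BilinForm.Nondegenerate
      (dotProductBilin (ZMod p) (ZMod p) : LinearMap.BilinForm (ZMod p) (ι → ZMod p)) :=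
  ⟨fun x h => dotProduct_eq_zero x h,
    fun x h => dotProduct_eq_zero x fun y => by rw [dotProduct_comm]; exact h y⟩

theorem finrank_dualCode (C : Submodule (ZMod p) (ι → ZMod p)) :
    Module.finrank (ZMod p) (dualCode C) = Fintype.card ι - Module.finrank (ZMod p) C := by
  rw [dualCode_eq_orthogonal, LinearMap.BilinForm.finrank_orthogonal dotProductBilin_nondegenerate,
    Module.finrank_fintype_fun_eq_card]

theorem dualCode_dualCode (C : Submodule (ZMod p) (ι → ZMod p)) :
    dualCode (dualCode C) = C := by
  rw [dualCode_eq_orthogonal, dualCode_eq_orthogonal]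
  refine LinearMap.BilinForm.orthogonal_orthogonal dotProductBilin_nondegenerate ?_ C
  intro x y h
  exact (dotProduct_comm y x).trans h

theorem IsLCD.dualCode {C : Submodule (ZMod p) (ι → ZMod p)} (h : IsLCD C) :
    IsLCD (dualCode C) := by
  rw [IsLCD, dualCode_dualCode, inf_comm]
  exact h

theorem mem_rowSpan_iff {G : Matrix k ι (ZMod p)} {w : ι → ZMod p} :
    w ∈ rowSpan G ↔ ∃ u, u ᵥ* G = w := by
  rw [rowSpan, ← range_vecMulLinear]
  rfl

theorem mem_augCode_iff {G : Matrix k ι (ZMod p)} {w : k ⊕ ι → ZMod p} :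
    w ∈ augCode G ↔ ∃ u, Sum.elim u (u ᵥ* G) = w := by
  rw [augCode, mem_rowSpan_iff]
  simp

theorem finrank_augCode (G : Matrix k ι (ZMod p)) :
    Module.finrank (ZMod p) (augCode G) = Fintype.card k := by
  rw [augCode, rowSpan, ← range_vecMulLinear, LinearMap.finrank_range_of_inj,
    Module.finrank_fintype_fun_eq_card]
  intro u v h
  simp only [vecMulLinear_apply, vecMul_fromCols, vecMul_one] at h
  exact funext fun i => congrFun h (Sum.inl i)

theorem isLCD_augCode {G : Matrix k ι (ZMod p)}
    (h : ∀ u v : k → ZMod p, (u ᵥ* G) ⬝ᵥ (v ᵥ* G) = 0) : IsLCD (augCode G) := by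
  rw [IsLCD, eq_bot_iff]
  rintro w ⟨hw, hw'⟩
  obtain ⟨u, rfl⟩ := mem_augCode_iff.1 hw
  have hu : u = 0 := by
    refine dotProduct_eq_zero u fun v => ?_
    have := hw' _ (mem_augCode_iff.2 ⟨v, rfl⟩)
    rwa [sumElim_dotProduct_sumElim, h, add_zero] at this
  rw [Submodule.mem_bot, hu, zero_vecMul]
  exact Sum.elim_zero_zero

theorem mem_dualCode_augCode_iff {G : Matrix k ι (ZMod p)} {w : k ⊕ ι → ZMod p} :
    w ∈ dualCode (augCode G) ↔ ∀ i, w (Sum.inl i) + ∑ d, G i d * w (Sum.inr d) = 0 := by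
  have h : ∀ u, w ⬝ᵥ Sum.elim u (u ᵥ* G) =
      (fun i => w (Sum.inl i) + ∑ d, G i d * w (Sum.inr d)) ⬝ᵥ u := by
    intro u
    have h1 : w ⬝ᵥ Sum.elim u (u ᵥ* G) =
        (w ∘ Sum.inl) ⬝ᵥ u + (u ᵥ* G) ⬝ᵥ (w ∘ Sum.inr) := by
      rw [← Sum.elim_comp_inl_inr w, sumElim_dotProduct_sumElim, dotProduct_comm (u ᵥ* G)]
      rfl
    rw [h1, ← dotProduct_mulVec, dotProduct_comm u, ← add_dotProduct]
    rfl
  constructor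
  · intro hw i
    have h0 : (fun i => w (Sum.inl i) + ∑ d, G i d * w (Sum.inr d)) = 0 :=
      dotProduct_eq_zero _ fun u => by
        rw [← h]
        exact hw _ (mem_augCode_iff.2 ⟨u, rfl⟩)
    exact congrFun h0 i
  · intro hw y hy
    obtain ⟨u, rfl⟩ := mem_augCode_iff.1 hy
    rw [h, funext hw]
    exact zero_dotProduct u

theorem eq_zero_of_hammingNorm_le_two {ι : Type*} [Fintype ι] {w : ι → ZMod p}
    (h : hammingNorm w ≤ 2) {i j l : ι} (hi : w i ≠ 0) (hj : w j ≠ 0) (hij : i ≠ j)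
    (hli : l ≠ i) (hlj : l ≠ j) : w l = 0 := by
  classical
  by_contra hl
  have h1 : ({i, j, l} : Finset ι) ⊆ Finset.univ.filter fun x => w x ≠ 0 := by
    intro x hx
    simp only [Finset.mem_insert, Finset.mem_singleton] at hx
    rcases hx with rfl | rfl | rfl <;> simp [*]
  have h2 := Finset.card_le_card h1
  rw [Finset.card_eq_three.2 ⟨i, j, l, hij, hli.symm, hlj.symm, rfl⟩] at h2
  have h3 : hammingNorm w = (Finset.univ.filter fun x => w x ≠ 0).card := rfl
  omega

end LinearCodes

/-! ### Self-orthogonality of the code of `f`. -/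

section SelfOrthogonal

variable {p : ℕ} [Fact p.Prime] {V : Type*} [AddCommGroup V] [Module (ZMod p) V] [Fintype V]
  {B : LinearMap.BilinForm (ZMod p) V} {s : ℕ} {f : V → ZMod p}

theorem sum_support_eq_sum_ite (h : V → ZMod p) :
    ∑ x : {x : V // f x ≠ 0}, h x = ∑ x, if f x ≠ 0 then h x else 0 := by
  rw [← Finset.sum_filter]
  exact (Finset.sum_subtype _ (by simp) h).symm

theorem sum_comp_eq_zero {T : Type*} [DecidableEq T] (g : V → T) (F : T → ZMod p)
    (h : ∀ c, p ∣ (Finset.univ.filter fun x => g x = c).card) : ∑ x, F (g x) = 0 := by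
  rw [Finset.sum_comp]
  refine Finset.sum_eq_zero fun c _ => ?_
  rw [nsmul_eq_mul, (ZMod.natCast_eq_zero_iff _ _).2 (h c), zero_mul]

theorem sum_support_sq (hp : p ≠ 2) (hpl : IsPlateaued B s f) (h3 : 3 ≤ dim p V + s) :
    ∑ x : {x : V // f x ≠ 0}, f x * f x = 0 := by
  rw [sum_support_eq_sum_ite fun x => f x * f x]
  exact sum_comp_eq_zero f (fun c => if c ≠ 0 then c * c else 0) (dvd_card_fiber hp hpl h3)

theorem sum_support_mul_bilin (hp : p ≠ 2) (hev : ∀ x, f (-x) = f x) (b : V) :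
    ∑ x : {x : V // f x ≠ 0}, f x * B b x = 0 := by
  rw [sum_support_eq_sum_ite fun x => f x * B b x]
  have h := Equiv.sum_comp (Equiv.neg V) fun x => if f x ≠ 0 then f x * B b x else 0
  have h1 : ∀ x : V, (if f (Equiv.neg V x) ≠ 0 then f (Equiv.neg V x) * B b (Equiv.neg V x) else 0) =
      -(if f x ≠ 0 then f x * B b x else 0) := by
    intro x
    rw [Equiv.neg_apply, hev, map_neg, mul_neg]
    split_ifs <;> simp
  rw [Finset.sum_congr rfl fun x _ => h1 x, Finset.sum_neg_distrib, neg_eq_iff_add_eq_zero,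
    ← two_mul] at h
  exact (mul_eq_zero.1 h).resolve_left (two_ne_zero_zmod hp)

/-- The substitution `x ↦ 2x` preserves the support and multiplies the sum by 4, so three times the
sum is zero. This says nothing for `p = 3`, where the joint fibre sizes are used. -/
theorem sum_support_bilin_sq (hp : p ≠ 2) (hnd : B.Nondegenerate) (hpl : IsPlateaued B s f)
    (hsm : ∀ x, f ((2 : ZMod p) • x) ≠ 0 ↔ f x ≠ 0) (h5 : p = 3 → 5 ≤ dim p V + s) (b : V) :
    ∑ x : {x : V // f x ≠ 0}, B b x * B b x = 0 := by
  rcases eq_or_ne b 0 with rfl | hb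
  · simp
  rw [sum_support_eq_sum_ite fun x => B b x * B b x]
  by_cases hp3 : p = 3
  · refine sum_comp_eq_zero (fun x => (f x, B b x))
      (fun c => if c.1 ≠ 0 then c.2 * c.2 else 0) fun c => ?_
    simpa only [Prod.ext_iff] using dvd_card_joint_fiber hp hnd hpl (h5 hp3) hb c.1 c.2
  · have h := (Equiv.smulRight (β := V) (two_ne_zero_zmod hp)).sum_comp
      fun x => if f x ≠ 0 then B b x * B b x else 0
    have h1 : ∀ x : V, (if f (Equiv.smulRight (two_ne_zero_zmod hp) x) ≠ 0 then
        B b (Equiv.smulRight (two_ne_zero_zmod hp) x) *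
          B b (Equiv.smulRight (two_ne_zero_zmod hp) x) else 0) =
        4 * (if f x ≠ 0 then B b x * B b x else 0) := by
      intro x
      simp only [Equiv.smulRight_apply, hsm, map_smul, smul_eq_mul]
      split_ifs
      · ring
      · simp
    rw [Finset.sum_congr rfl fun x _ => h1 x, ← Finset.mul_sum, ← sub_eq_zero] at h
    have h3 : (3 : ZMod p) ≠ 0 := by
      have : ((3 : ℕ) : ZMod p) ≠ 0 := by
        rw [Ne, ZMod.natCast_eq_zero_iff]
        exact fun h => hp3 ((Nat.prime_dvd_prime_iff_eq Fact.out Nat.prime_three).1 h)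
      exact_mod_cast this
    refine (mul_eq_zero_iff_left h3).1 ?_
    linear_combination h

theorem codeF_dotProduct (hp : p ≠ 2) (hnd : B.Nondegenerate) (hpl : IsPlateaued B s f)
    (hev : ∀ x, f (-x) = f x) (hsm : ∀ x, f ((2 : ZMod p) • x) ≠ 0 ↔ f x ≠ 0)
    (h3 : 3 ≤ dim p V + s) (h5 : p = 3 → 5 ≤ dim p V + s)
    {c c' : {x : V // f x ≠ 0} → ZMod p} (hc : c ∈ codeF B f) (hc' : c' ∈ codeF B f) :
    c ⬝ᵥ c' = 0 := by
  obtain ⟨a, b, h⟩ := hc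
  obtain ⟨a', b', h'⟩ := hc'
  -- Polarization of the vanishing sums of squares.
  have hpol : ∑ x : {x : V // f x ≠ 0}, B b x * B b' x = 0 := by
    refine (mul_eq_zero_iff_left (two_ne_zero_zmod hp)).1 ?_
    have e1 := sum_support_bilin_sq hp hnd hpl hsm h5 (b + b')
    have e2 := sum_support_bilin_sq hp hnd hpl hsm h5 b
    have e3 := sum_support_bilin_sq hp hnd hpl hsm h5 b'
    have : ∑ x : {x : V // f x ≠ 0}, B (b + b') x * B (b + b') x =
        ∑ x : {x : V // f x ≠ 0}, B b x * B b x + 2 * ∑ x : {x : V // f x ≠ 0}, B b x * B b' x +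
          ∑ x : {x : V // f x ≠ 0}, B b' x * B b' x := by
      rw [Finset.mul_sum, ← Finset.sum_add_distrib, ← Finset.sum_add_distrib]
      refine Finset.sum_congr rfl fun x _ => ?_
      rw [map_add, LinearMap.add_apply]; ring
    rwa [e1, e2, e3, zero_add, add_zero, eq_comm] at this
  have : c ⬝ᵥ c' = a * a' * ∑ x : {x : V // f x ≠ 0}, f x * f x +
      a * ∑ x : {x : V // f x ≠ 0}, f x * B b' x + a' * ∑ x : {x : V // f x ≠ 0}, f x * B b x +
        ∑ x : {x : V // f x ≠ 0}, B b x * B b' x := by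
    rw [Finset.mul_sum, Finset.mul_sum, Finset.mul_sum, ← Finset.sum_add_distrib,
      ← Finset.sum_add_distrib, ← Finset.sum_add_distrib]
    refine Finset.sum_congr rfl fun x _ => ?_
    rw [h, h']; ring
  rw [this, sum_support_sq hp hpl h3, sum_support_mul_bilin hp hev, sum_support_mul_bilin hp hev,
    hpol]
  ring

end SelfOrthogonal

/-! ### The standard generator matrix and the dual distance. -/

section StdMatrix

open Matrix

variable {p : ℕ} [Fact p.Prime] {V : Type*} [AddCommGroup V] [Module (ZMod p) V] [Fintype V]
  {B : LinearMap.BilinForm (ZMod p) V} {s : ℕ} {f : V → ZMod p}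

theorem card_support_add :
    Fintype.card {x : V // f x ≠ 0} + (Finset.univ.filter fun x => f x = 0).card = p ^ dim p V := by
  rw [← card_eq_pow_dim, Fintype.card_subtype, add_comm,
    Finset.card_filter_add_card_filter_not, Finset.card_univ]

theorem card_hyperplane (hnd : B.Nondegenerate) {b : V} (hb : b ≠ 0) :
    p * (Finset.univ.filter fun x => B b x = 0).card = p ^ dim p V := by
  have h := natCast_mul_card_fiber (fun x => B b x) 0
  rw [Finset.sum_eq_single 0] at h
  · simp only [zero_mul, neg_zero, AddChar.map_zero_eq_one, Finset.sum_const, Finset.card_univ,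
      card_eq_pow_dim (p := p) (V := V), one_mul, nsmul_eq_mul, mul_one] at h
    exact_mod_cast h
  · intro a _ ha
    have h1 : ∑ x, rootChar p (a * B b x) = 0 := by
      refine sum_rootChar_linear (l := a • B b) fun h0 => ?_
      have h2 : a • b = 0 := hnd.1 _ fun y => by rw [map_smul, h0, LinearMap.zero_apply]
      exact (smul_ne_zero ha hb) h2
    rw [h1, mul_zero]
  · simp

/-- Subtracting the relations at `x` and `-x` kills the even part, so the linear form vanishes on
the support; `hbig` says that the support is too large to fit in a hyperplane. -/
theorem eq_zero_of_forall_support (hp : p ≠ 2) (hnd : B.Nondegenerate)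
    (hev : ∀ x, f (-x) = f x) (hbig : p ^ dim p V < p * Fintype.card {x : V // f x ≠ 0})
    {a : ZMod p} {b : V} (h : ∀ x, f x ≠ 0 → a * f x + B b x = 0) : a = 0 ∧ b = 0 := by
  have hB : ∀ x, f x ≠ 0 → B b x = 0 := by
    intro x hx
    have h1 := h x hx
    have h2 := h (-x) (by rwa [hev])
    rw [hev, map_neg] at h2
    have h3 : 2 * B b x = 0 := by linear_combination h1 - h2
    exact (mul_eq_zero.1 h3).resolve_left (two_ne_zero_zmod hp)
  have hb : b = 0 := by
    by_contra hb
    rw [← card_hyperplane hnd hb, Fintype.card_subtype] at hbig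
    have hle : (Finset.univ.filter fun x => f x ≠ 0).card ≤
        (Finset.univ.filter fun x => B b x = 0).card :=
      Finset.card_le_card fun x hx => by
        simp only [Finset.mem_filter, Finset.mem_univ, true_and] at hx ⊢
        exact hB x hx
    exact absurd hbig (not_lt.2 (Nat.mul_le_mul_left p hle))
  have hpos : 0 < Fintype.card {x : V // f x ≠ 0} := by
    by_contra h0
    rw [Nat.eq_zero_of_not_pos h0, mul_zero] at hbig
    omega
  obtain ⟨x⟩ := Fintype.card_pos_iff.1 hpos
  have h1 := h x x.2
  rw [hB x x.2, add_zero] at h1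
  exact ⟨(mul_eq_zero.1 h1).resolve_right x.2, hb⟩

theorem vecMul_stdMatrix {n : ℕ} (α : Fin n → V) (u : Fin (n + 1) → ZMod p)
    (x : {x : V // f x ≠ 0}) :
    (u ᵥ* stdMatrix B f α) x = u 0 * f x + B (∑ i, u i.succ • α i) x := by
  simp [vecMul, dotProduct, stdMatrix, Fin.sum_univ_succ]

theorem isGeneratorMatrix_stdMatrix {n : ℕ} (hp : p ≠ 2) (hnd : B.Nondegenerate)
    (hev : ∀ x, f (-x) = f x) (hbig : p ^ dim p V < p * Fintype.card {x : V // f x ≠ 0})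
    (α : Module.Basis (Fin n) (ZMod p) V) :
    IsGeneratorMatrix (stdMatrix B f α) (codeF B f) := by
  constructor
  · rw [← vecMul_injective_iff, ← coe_vecMulLinear, ← LinearMap.ker_eq_bot, LinearMap.ker_eq_bot']
    intro u hu
    obtain ⟨h0, hb⟩ := eq_zero_of_forall_support hp hnd hev hbig (a := u 0)
      (b := ∑ i, u i.succ • α i) fun x hx => by
        have := congrFun hu ⟨x, hx⟩
        rwa [vecMulLinear_apply, vecMul_stdMatrix] at this
    have hs := Fintype.linearIndependent_iff.1 α.linearIndependent (fun i => u i.succ) hb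
    funext i
    exact Fin.cases h0 hs i
  · ext c
    rw [mem_rowSpan_iff]
    constructor
    · rintro ⟨u, rfl⟩
      exact ⟨u 0, _, vecMul_stdMatrix _ u⟩
    · rintro ⟨a, b, h⟩
      refine ⟨Fin.cons a (α.repr b), ?_⟩
      funext x
      rw [vecMul_stdMatrix, h]
      simp only [Fin.cons_zero, Fin.cons_succ, α.sum_repr]

/-- The columns of `[I, G]` are pairwise independent. Two dependent columns of `G` at `d`, `d'` give
`d' = a d` and `f d' = a f d`, so `a = 1`. A column of `G` proportional to a unit vector can only
match the first one, since `f d ≠ 0`, and then `d = 0`, against `f 0 = 0`. -/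
theorem three_le_hammingNorm {n : ℕ} (hnd : B.Nondegenerate) (hf0 : f 0 = 0)
    (hsm : ∀ (a : ZMod p) (x : V), a ≠ 0 → f x ≠ 0 → f (a • x) = a * f x → a = 1)
    (α : Module.Basis (Fin n) (ZMod p) V) {w : Fin (n + 1) ⊕ {x : V // f x ≠ 0} → ZMod p}
    (hw : w ∈ dualCode (augCode (stdMatrix B f α))) (hw0 : w ≠ 0) : 3 ≤ hammingNorm w := by
  classical
  by_contra hlt
  have hle : hammingNorm w ≤ 2 := by omega
  rw [mem_dualCode_augCode_iff] at hw
  have hfst : w (Sum.inl 0) + ∑ d : {x : V // f x ≠ 0}, f d * w (Sum.inr d) = 0 := hw 0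
  have hsucc : ∀ i : Fin n,
      w (Sum.inl i.succ) + B (α i) (∑ d : {x : V // f x ≠ 0}, w (Sum.inr d) • (d : V)) = 0 := by
    intro i
    rw [map_sum]
    refine Eq.trans (congrArg _ (Finset.sum_congr rfl fun d _ => ?_)) (hw i.succ)
    rw [map_smul, smul_eq_mul, mul_comm]
    rfl
  have hsep : ∀ v, (∀ i, B (α i) v = 0) → v = 0 := by
    intro v hv
    refine hnd.2 v fun y => ?_
    have : B.flip v = 0 := α.ext hv
    exact LinearMap.congr_fun this y
  have hex : ∃ d, w (Sum.inr d) ≠ 0 := by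
    by_contra! h
    apply hw0
    funext i
    rcases i with i | d
    · have := hw i
      simpa [h] using this
    · exact h d
  obtain ⟨d, hd⟩ := hex
  by_cases hex2 : ∃ d', d' ≠ d ∧ w (Sum.inr d') ≠ 0
  · obtain ⟨d', hne, hd'⟩ := hex2
    have hl : ∀ i, w (Sum.inl i) = 0 := fun i =>
      eq_zero_of_hammingNorm_le_two hle hd hd' (by simpa using hne.symm) (by simp) (by simp)
    have hr : ∀ e, e ≠ d ∧ e ≠ d' → w (Sum.inr e) = 0 := fun e he =>
      eq_zero_of_hammingNorm_le_two hle hd hd' (by simpa using hne.symm)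
        (by simpa using he.1) (by simpa using he.2)
    have hv := hsep _ fun i => by have := hsucc i; rwa [hl, zero_add] at this
    rw [hl, zero_add] at hfst
    rw [Fintype.sum_eq_add d d' hne.symm fun e he => by rw [hr e he, mul_zero]] at hfst
    rw [Fintype.sum_eq_add d d' hne.symm fun e he => by rw [hr e he, zero_smul]] at hv
    set c := w (Sum.inr d)
    set c' := w (Sum.inr d')
    have hd'v : (d' : V) = (-(c / c')) • (d : V) := by
      have : c' • (d' : V) = -(c • (d : V)) := by rw [eq_neg_iff_add_eq_zero, add_comm, hv]
      rw [neg_smul, div_eq_inv_mul, mul_smul, ← smul_neg, ← this, inv_smul_smul₀ hd']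
    have h1 : -(c / c') = 1 := by
      refine hsm _ d (neg_ne_zero.2 (div_ne_zero hd hd')) d.2 ?_
      rw [← hd'v]
      field_simp
      linear_combination hfst
    rw [h1, one_smul] at hd'v
    exact hne (Subtype.ext hd'v)
  · push Not at hex2
    rw [Fintype.sum_eq_single d fun e he => by rw [hex2 e he, mul_zero]] at hfst
    have h0 : w (Sum.inl 0) ≠ 0 := by
      intro h
      rw [h, zero_add] at hfst
      exact mul_ne_zero d.2 hd hfst
    have hl : ∀ i : Fin n, w (Sum.inl i.succ) = 0 := fun i =>
      eq_zero_of_hammingNorm_le_two hle hd h0 (by simp) (by simp) (by simp)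
    have hv := hsep _ fun i => by have := hsucc i; rwa [hl, zero_add] at this
    rw [Fintype.sum_eq_single d fun e he => by rw [hex2 e he, zero_smul]] at hv
    have h1 := (smul_eq_zero.1 hv).resolve_left hd
    exact d.2 (by rw [h1, hf0])

theorem exists_hammingNorm_eq_three {n : ℕ} (hp : p ≠ 2) (hf0 : f 0 = 0)
    (hsm : ∀ (a : ZMod p) (x : V), a ≠ 0 → f x ≠ 0 → f (a • x) = a * f x → a = 1)
    (hsupp : ∀ x, f ((2 : ZMod p) • x) ≠ 0 ↔ f x ≠ 0) (hne : Nonempty {x : V // f x ≠ 0})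
    (α : Fin n → V) :
    ∃ w ∈ dualCode (augCode (stdMatrix B f α)), hammingNorm w = 3 := by
  classical
  obtain ⟨d⟩ := hne
  have h21 : (2 : ZMod p) ≠ 1 := by
    intro h
    have : (1 : ZMod p) = 0 := by linear_combination h
    exact one_ne_zero this
  have he : f ((2 : ZMod p) • (d : V)) - 2 * f d ≠ 0 := fun h =>
    h21 (hsm 2 d (two_ne_zero_zmod hp) d.2 (sub_eq_zero.1 h))
  set x : {x : V // f x ≠ 0} := ⟨(2 : ZMod p) • (d : V), (hsupp d).2 d.2⟩ with hx
  have hxd : x ≠ d := by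
    intro h
    have h1 : (2 : ZMod p) • (d : V) = d := congrArg Subtype.val h
    rw [two_smul, add_eq_left] at h1
    exact d.2 (by rw [h1, hf0])
  -- The columns at `2d` and `d`, with coefficients 1 and `-2`, cancel in every linear row; the row
  -- of `f` leaves `f (2d) - 2 f d`, nonzero because `2 ≠ 1`, and the first unit column absorbs it.
  refine ⟨Sum.elim (Pi.single 0 (-(f ((2 : ZMod p) • (d : V)) - 2 * f d)))
    (Pi.single x 1 + Pi.single d (-2)), mem_dualCode_augCode_iff.2 fun i => ?_, ?_⟩
  · simp only [Sum.elim_inl, Sum.elim_inr, Pi.add_apply, mul_add, Finset.sum_add_distrib,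
      Pi.single_apply, mul_ite, mul_zero, Finset.sum_ite_eq', Finset.mem_univ, if_true, mul_one]
    refine Fin.cases ?_ (fun j => ?_) i
    · simp only [stdMatrix, of_apply, Fin.cons_zero, if_true, hx]
      ring
    · simp only [stdMatrix, of_apply, Fin.cons_succ, Fin.succ_ne_zero, if_false, hx, map_smul,
        smul_eq_mul]
      ring
  · rw [hammingNorm, Finset.card_eq_three]
    refine ⟨Sum.inl 0, Sum.inr x, Sum.inr d, by simp, by simp, by simpa using hxd, ?_⟩
    ext i
    rcases i with i | e
    · by_cases hi : i = 0
      · subst hi; simpa using fun h => he (by linear_combination -h)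
      · simp [hi]
    · by_cases h1 : e = x
      · subst h1; simp [hxd]
      · by_cases h2 : e = d
        · subst h2; simp [hxd.symm, two_ne_zero_zmod hp]
        · simp [h1, h2]

theorem hasMinDist_dualCode_stdMatrix {n : ℕ} (hp : p ≠ 2) (hnd : B.Nondegenerate) (hf0 : f 0 = 0)
    (hsm : ∀ (a : ZMod p) (x : V), a ≠ 0 → f x ≠ 0 → f (a • x) = a * f x → a = 1)
    (hsupp : ∀ x, f ((2 : ZMod p) • x) ≠ 0 ↔ f x ≠ 0) (hne : Nonempty {x : V // f x ≠ 0})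
    (α : Module.Basis (Fin n) (ZMod p) V) :
    HasMinDist (dualCode (augCode (stdMatrix B f α))) 3 := by
  constructor
  · obtain ⟨w, hw, h3⟩ := exists_hammingNorm_eq_three (B := B) hp hf0 hsm hsupp hne α
    refine ⟨w, hw, 0, Submodule.zero_mem _, ?_, by rw [hammingDist_zero_right, h3]⟩
    rintro rfl
    simp at h3
  · rintro _ ⟨c, hc, c', hc', hne, rfl⟩
    rw [hammingDist_eq_hammingNorm]
    refine three_le_hammingNorm hnd hf0 hsm α
      (Submodule.add_mem _ (Submodule.neg_mem _ hc) hc') fun h => hne ?_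
    exact neg_add_eq_zero.1 h

theorem params_of_card {n : ℕ} {N : ℤ} (hp : p ≠ 2) (hn : dim p V = n) (hsymm : B.IsSymm)
    (hnd : B.Nondegenerate) (hf : MemF B s f) (h3 : 3 ≤ n + s) (h5 : p = 3 → 5 ≤ n + s)
    (hN : (Fintype.card {x : V // f x ≠ 0} : ℤ) = N) (hbig : (p : ℤ) ^ n < p * N) :
    (∀ G : Matrix (Fin (n + 1)) {x : V // f x ≠ 0} (ZMod p),
      IsGeneratorMatrix G (codeF B f) →
      HasParams (augCode G) (N + n + 1) (n + 1) ∧ IsLCD (augCode G) ∧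
      HasParams (dualCode (augCode G)) (N + n + 1) N ∧ IsLCD (dualCode (augCode G))) ∧
    (∀ α : Module.Basis (Fin n) (ZMod p) V,
      IsGeneratorMatrix (stdMatrix B f α) (codeF B f) ∧
      HasMinDist (dualCode (augCode (stdMatrix B f α))) 3) := by
  subst hn
  have hev := apply_neg hp hsymm hnd hf
  have hsupp := fun x => apply_smul_ne_zero hp hsymm hnd hf (two_ne_zero_zmod hp) x
  have hbig' : p ^ dim p V < p * Fintype.card {x : V // f x ≠ 0} := by
    rw [← hN] at hbig
    exact_mod_cast hbig
  constructor
  · rintro G ⟨-, hG⟩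
    have hrow : ∀ u, u ᵥ* G ∈ codeF B f := fun u => hG ▸ mem_rowSpan_iff.2 ⟨u, rfl⟩
    have hlcd : IsLCD (augCode G) := isLCD_augCode fun u v =>
      codeF_dotProduct hp hnd hf.plateaued hev hsupp h3 h5 (hrow u) (hrow v)
    have hlen : (Fintype.card (Fin (dim p V + 1) ⊕ {x : V // f x ≠ 0}) : ℤ) =
        N + (dim p V : ℤ) + 1 := by
      rw [Fintype.card_sum, Fintype.card_fin]
      push_cast
      rw [hN]
      ring
    refine ⟨⟨hlen, ?_⟩, hlcd, ⟨hlen, ?_⟩, hlcd.dualCode⟩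
    · rw [finrank_augCode, Fintype.card_fin]
      push_cast; rfl
    · rw [finrank_dualCode, finrank_augCode, Fintype.card_sum, Nat.add_sub_cancel_left, hN]
  · intro α
    refine ⟨isGeneratorMatrix_stdMatrix hp hnd hev hbig' α,
      hasMinDist_dualCode_stdMatrix hp hnd hf.map_zero
        (fun a x ha hx h => eq_one_of_apply_smul hp hsymm hnd hf ha hx h) hsupp ?_ α⟩
    rw [← Fintype.card_pos_iff]
    by_contra h0
    rw [Nat.eq_zero_of_not_pos h0, mul_zero] at hbig'
    omega

end StdMatrix

end PlateauedLCD

end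

/-! ### Assembly: the length from the zero count, and the support outgrowing a hyperplane. -/

theorem theorem10 {p : ℕ} [Fact p.Prime] (hp : p ≠ 2)
    {V : Type*} [AddCommGroup V] [Module (ZMod p) V] [Fintype V]
    (n s : ℕ) (hn : Module.finrank (ZMod p) V = n)
    (B : LinearMap.BilinForm (ZMod p) V) (hsymm : B.IsSymm) (hnd : B.Nondegenerate)
    (f : V → ZMod p) (hf : PlateauedLCD.MemF B s f) :
    -- the case of even `n + s`
    (∀ N : ℤ, Even (n + s) → s + 2 ≤ n → (p = 3 → 6 ≤ n + s) → (p ≠ 3 → 4 ≤ n + s) →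
      N = ((p : ℤ) - 1) *
        ((p : ℤ) ^ (n - 1) - PlateauedLCD.eps B s f 0 * (p : ℤ) ^ ((n + s) / 2 - 1)) →
      (PlateauedLCD.eps B s f 0 = 1 ∨ PlateauedLCD.eps B s f 0 = -1) ∧
      -- every generator matrix `G` of the code of `f`
      (∀ G : Matrix (Fin (n + 1)) {x : V // f x ≠ 0} (ZMod p),
        PlateauedLCD.IsGeneratorMatrix G (PlateauedLCD.codeF B f) →
        PlateauedLCD.HasParams (PlateauedLCD.augCode G) (N + n + 1) (n + 1) ∧
        PlateauedLCD.IsLCD (PlateauedLCD.augCode G) ∧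
        PlateauedLCD.HasParams (PlateauedLCD.dualCode (PlateauedLCD.augCode G)) (N + n + 1) N ∧
        PlateauedLCD.IsLCD (PlateauedLCD.dualCode (PlateauedLCD.augCode G))) ∧
      -- the generator matrix with rows `(f(x))`, `(⟨α_1, x⟩)`, …, `(⟨α_n, x⟩)`
      (∀ α : Module.Basis (Fin n) (ZMod p) V,
        PlateauedLCD.IsGeneratorMatrix (PlateauedLCD.stdMatrix B f α) (PlateauedLCD.codeF B f) ∧
        PlateauedLCD.HasMinDist
          (PlateauedLCD.dualCode (PlateauedLCD.augCode (PlateauedLCD.stdMatrix B f α))) 3)) ∧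
    -- the case of odd `n + s`
    (∀ N : ℤ, Odd (n + s) → s + 1 ≤ n → (p = 3 → 5 ≤ n + s) → (p ≠ 3 → 3 ≤ n + s) →
      N = ((p : ℤ) - 1) * (p : ℤ) ^ (n - 1) →
      (∀ G : Matrix (Fin (n + 1)) {x : V // f x ≠ 0} (ZMod p),
        PlateauedLCD.IsGeneratorMatrix G (PlateauedLCD.codeF B f) →
        PlateauedLCD.HasParams (PlateauedLCD.augCode G) (N + n + 1) (n + 1) ∧
        PlateauedLCD.IsLCD (PlateauedLCD.augCode G) ∧
        PlateauedLCD.HasParams (PlateauedLCD.dualCode (PlateauedLCD.augCode G)) (N + n + 1) N ∧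
        PlateauedLCD.IsLCD (PlateauedLCD.dualCode (PlateauedLCD.augCode G))) ∧
      (∀ α : Module.Basis (Fin n) (ZMod p) V,
        PlateauedLCD.IsGeneratorMatrix (PlateauedLCD.stdMatrix B f α) (PlateauedLCD.codeF B f) ∧
        PlateauedLCD.HasMinDist
          (PlateauedLCD.dualCode (PlateauedLCD.augCode (PlateauedLCD.stdMatrix B f α))) 3)) := by
  have hp3 : 3 ≤ p := lt_of_le_of_ne (Fact.out : p.Prime).two_le (Ne.symm hp)
  have hdim : PlateauedLCD.dim p V = n := hn
  have hev := PlateauedLCD.apply_neg hp hsymm hnd hf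
  have hcard := PlateauedLCD.card_support_add (f := f)
  have hp0 : (p : ℤ) ≠ 0 := by positivity
  refine ⟨fun N heven hs h6 h4 hN => ?_, fun N hodd hs h5 h3 hN => ?_⟩
  · have heps := (PlateauedLCD.eps_zero hp hf.plateaued hf.map_zero hev).1
    have hz := PlateauedLCD.card_zero_fiber_of_even hp hf.plateaued hf.map_zero hev
      (by rwa [hdim])
    rw [hdim] at hz hcard
    set e := PlateauedLCD.eps B s f 0
    set z := (Finset.univ.filter fun x => f x = 0).card
    set c := Fintype.card {x : V // f x ≠ 0}
    have hcard' : (c : ℤ) + z = (p : ℤ) ^ n := by exact_mod_cast hcard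
    obtain ⟨m, hm⟩ : ∃ m, n = m + 2 := ⟨n - 2, by omega⟩
    obtain ⟨r, hr⟩ : ∃ r, (n + s) / 2 = r + 1 := ⟨(n + s) / 2 - 1, by omega⟩
    have hrm : r ≤ m := by omega
    have hcN : (c : ℤ) = N := by
      apply mul_left_cancel₀ hp0
      rw [hN, hr, hm]
      rw [hr, hm] at hz
      rw [hm] at hcard'
      simp only [Nat.add_sub_cancel, show m + 2 - 1 = m + 1 by omega]
      linear_combination (p : ℤ) * hcard' - hz
    refine ⟨heps, PlateauedLCD.params_of_card hp hdim hsymm hnd hf (by omega)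
      (fun h => by have := h6 h; omega) hcN ?_⟩
    have hp3' : (3 : ℤ) ≤ p := by exact_mod_cast hp3
    have hpr : (p : ℤ) ^ r ≤ p ^ m := pow_le_pow_right₀ (by linarith) hrm
    have hpr0 : (0 : ℤ) < p ^ r := by positivity
    -- The worst case is `e = 1`, where `r ≤ m` is needed; that inequality comes from `s + 2 ≤ n`.
    have hle : (p : ℤ) ^ (m + 1) - p ^ m ≤ p ^ (m + 1) - e * p ^ r := by
      rcases heps with h | h <;> rw [h] <;> linarith
    have hpm : (0 : ℤ) < p ^ m := by positivity
    have hN' : ((p : ℤ) - 1) * (p ^ (m + 1) - p ^ m) ≤ N := by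
      rw [hN, hr, hm]
      simp only [Nat.add_sub_cancel, show m + 2 - 1 = m + 1 by omega]
      exact mul_le_mul_of_nonneg_left hle (by linarith)
    have hlt : (p : ℤ) ^ (m + 1) < N := by
      refine lt_of_lt_of_le ?_ hN'
      have : ((p : ℤ) - 1) * (p ^ (m + 1) - p ^ m) - p ^ (m + 1) =
          p ^ m * ((p : ℤ) * (p - 3) + 1) := by ring
      have h2 : (0 : ℤ) < p ^ m * ((p : ℤ) * (p - 3) + 1) := by
        apply mul_pos hpm
        nlinarith
      linarith
    rw [hm, pow_succ' (p : ℤ) (m + 1)]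
    exact mul_lt_mul_of_pos_left hlt (by linarith)
  · have hz := PlateauedLCD.card_zero_fiber_of_odd hp hf.plateaued hf.map_zero hev
      (by rwa [hdim])
    rw [hdim] at hz hcard
    set z := (Finset.univ.filter fun x => f x = 0).card
    set c := Fintype.card {x : V // f x ≠ 0}
    have hcard' : (c : ℤ) + z = (p : ℤ) ^ n := by exact_mod_cast hcard
    have hz' : (p : ℤ) * z = (p : ℤ) ^ n := by exact_mod_cast hz
    obtain ⟨m, hm⟩ : ∃ m, n = m + 1 := ⟨n - 1, by omega⟩
    have hcN : (c : ℤ) = N := by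
      apply mul_left_cancel₀ hp0
      rw [hN, hm]
      rw [hm] at hz' hcard'
      simp only [Nat.add_sub_cancel]
      linear_combination (p : ℤ) * hcard' - hz'
    refine PlateauedLCD.params_of_card hp hdim hsymm hnd hf
      (by by_cases h : p = 3
          · have := h5 h; omega
          · exact h3 h) h5 hcN ?_
    have hp3' : (3 : ℤ) ≤ p := by exact_mod_cast hp3
    have hpm : (0 : ℤ) < p ^ m := by positivity
    rw [hN, hm, pow_succ' (p : ℤ) m, Nat.add_sub_cancel]
    refine mul_lt_mul_of_pos_left ?_ (by linarith)
    nlinarith
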